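/- **Theorem 5.1.** Let $w:[0,+\infty)\to(0,+\infty)$ be a weight function, that is, a non-decreasing, continuous and unbounded function. For functions $u,v:X\to[0,+\infty)$ on a set $X$, write $u\asymp v$ (and call $u$, $v$ equivalent) if there are constants $C_1,C_2>0$ with $C_1u(x)\le v(x)\le C_2u(x)$ for all $x\in X$. Let $|\cdot|$ be the Euclidean norm on $\mathbb C^d$. For $d\ge 1$ consider the following properties. - $(\mathrm{app})_d$: $w$ on $\mathbb C^d$ is approximable by a holomorphic map, i.e. there are $n\ge 1$ and a holomorphic map $f:\mathbb C^d\to\mathbb C^n$ such that $|f(z)|\asymp w(|z|)$, $z\in\mathbb C^d$. - $(\mathrm{max})_d$: there is an entire function $f:\mathbb C^d\to\mathbb C$ such that $M_f(t)\asymp w(t)$, $t\ge 0$, where $M_f(t)=\max\{|f(z)|:|z|=t\}$. - $(\mathrm{ess})_d$: $w$ is essential on $\mathbb C^d$, i.e. $\widetilde w(z)\asymp w(|z|)$, $z\in\mathbb C^d$, where $$\widetilde w(z)=\sup\{|f(z)|: f:\mathbb C^d\to\mathbb C \text{ entire},\ |f(\zeta)|\le w(|\zeta|)\text{ for all }\zeta\in\mathbb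 C^d\}.$$ Further, consider the following property. - $(\mathrm{trop})$: $w$ is equivalent to a log-tropical weight function, i.e. there are a weight function $v:[0,+\infty)\to(0,+\infty)$ with $v\asymp w$, a set $E\subset\{0,1,2,\dots\}$ and real numbers $b_j$, $j\in E$, such that $\log v(e^x)=\sup_{j\in E}(b_j+jx)$ for all $x\in\mathbb R$. Then the following seven statements are equivalent: $(\mathrm{app})_d$ holds for all $d\ge1$; $(\mathrm{app})_d$ holds for some $d\ge1$; $(\mathrm{max})_d$ holds for all $d\ge1$; $(\mathrm{max})_d$ holds for some $d\ge1$; $(\mathrm{ess})_d$ holds for all $d\ge1$; $(\mathrm{ess})_d$ holds for some $d\ge1$; $(\mathrm{trop})$ holds. -/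

import Mathlib

open scoped NNReal

namespace RadialWeight

/-- `ℂ^d` with its Euclidean (Hermitian) norm. -/
abbrev Cd (d : ℕ) : Type := EuclideanSpace ℂ (Fin d)

/-- A weight function `w : [0, ∞) → (0, ∞)`: positive, non-decreasing, continuous, unbounded. -/
structure IsWeight (w : ℝ≥0 → ℝ) : Prop where
  pos : ∀ t, 0 < w t
  mono : Monotone w
  cont : Continuous w
  unbounded : ¬ BddAbove (Set.range w)

/-- The equivalence `u ≍ v` of two functions on `X`. -/
def Equivalent {X : Type*} (u v : X → ℝ) : Prop :=
  ∃ C₁ C₂ : ℝ, 0 < C₁ ∧ 0 < C₂ ∧ ∀ x, C₁ * u x ≤ v x ∧ v x ≤ C₂ * u x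

/-- The radial extension `w(z) = w(|z|)` of a weight function to `ℂ^d`. -/
noncomputable def radial (d : ℕ) (w : ℝ≥0 → ℝ) (z : Cd d) : ℝ := w ‖z‖₊

/-- `w` is approximable by a holomorphic map `f : ℂ^d → ℂ^n`, for some `n ≥ 1`. -/
def IsApproximable (d : ℕ) (w : ℝ≥0 → ℝ) : Prop :=
  ∃ n : ℕ, 1 ≤ n ∧ ∃ f : Cd d → Cd n, Differentiable ℂ f ∧
    Equivalent (fun z => ‖f z‖) (radial d w)

/-- `M_f(t) = max {|f(z)| : |z| = t}`. -/
noncomputable def maxModulus {d : ℕ} (f : Cd d → ℂ) (t : ℝ≥0) : ℝ :=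
  sSup ((fun z => ‖f z‖) '' Metric.sphere (0 : Cd d) (t : ℝ))

/-- `w` is approximable by the maximum of the modulus of an entire function on `ℂ^d`. -/
def IsMaxApproximable (d : ℕ) (w : ℝ≥0 → ℝ) : Prop :=
  ∃ f : Cd d → ℂ, Differentiable ℂ f ∧ Equivalent (maxModulus f) w

/-- The associated weight of `w` on `ℂ^d`, that is, the pointwise supremum of `|f|` over all
entire functions `f` with `|f| ≤ w`. The set is non-empty and bounded by `w(|z|)`. -/
noncomputable def associatedWeight (d : ℕ) (w : ℝ≥0 → ℝ) (z : Cd d) : ℝ :=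
  sSup {r : ℝ | ∃ f : Cd d → ℂ, Differentiable ℂ f ∧ (∀ ζ, ‖f ζ‖ ≤ radial d w ζ) ∧ r = ‖f z‖}

/-- `w` is essential on `ℂ^d`. -/
def IsEssential (d : ℕ) (w : ℝ≥0 → ℝ) : Prop :=
  Equivalent (associatedWeight d w) (radial d w)

/-- A tropical power series on the real line: `Ψ(x) = sup_{j ∈ E} (b_j + j x)` with `E` a set of
non-negative integers, the supremum being finite for every `x`. -/
def IsTropicalPowerSeries (Ψ : ℝ → ℝ) : Prop :=
  ∃ (E : Set ℕ) (b : ℕ → ℝ), ∀ x : ℝ, IsLUB ((fun j : ℕ => b j + (j : ℝ) * x) '' E) (Ψ x)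

/-- The logarithmic transform `x ↦ log v(e^x)`. -/
noncomputable def logTransform (v : ℝ≥0 → ℝ) (x : ℝ) : ℝ :=
  Real.log (v (Real.exp x).toNNReal)

/-- `v` is log-tropical. -/
def IsLogTropical (v : ℝ≥0 → ℝ) : Prop := IsTropicalPowerSeries (logTransform v)

/-- `w` is equivalent to a log-tropical weight function. -/
def IsTropicallyEquivalent (w : ℝ≥0 → ℝ) : Prop :=
  ∃ v : ℝ≥0 → ℝ, IsWeight v ∧ IsLogTropical v ∧ Equivalent w v

end RadialWeight

/-!
Both the analytic properties and the tropical one are statements about `log w (e^x)` and lines of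
non-negative integer slope, that is, moduli of monomials.

*From holomorphic functions to tropical series.* Restricting to complex lines, each of the
approximation properties gives `IsEssentialOnLine`: at each radius `t₀`, some entire function `g` of
one variable satisfies `|g| ≤ w` and `|g t₀| ≥ c * w t₀`. The natural candidate for a log-tropical
weight is the supremum `tropicalMinorant w` of all multiples of monomials below `w`. It is
comparable to `w` by `mul_le_tropicalMinorant`: let `k` be the integer part of the slope of `log w`
at `log t₀`. If the largest multiples of `t ^ k` and `t ^ (k + 1)` below `w` were both small at `t₀`,
this would be caused by values of `w` at radii `a` and `b` far to the left and far to the right of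
`t₀`. The Cauchy estimates on the circles of radius `a` (for the coefficients of degree `≤ k`) and
`b` (for the others) then bound `|g t₀|` by two geometric series, which is too little. The convexity
needed to define `k` is the maximum principle for `g z / z ^ (k + 1)` on annuli.

*From tropical series to holomorphic maps.* Essentiality is immediate from monomials. For the other
properties sums of monomials are needed, so the tropical series has to be thinned out. Among the
sets of lines which touch `Ψ` and whose envelope stays within `1` of `Ψ`, take a minimal one
(`IsTropicalWith.exists_minimal_cover`). Minimality forces every second line to drop by at least `1`
(`separated_of_minimal`), hence at each point the lines decay linearly with the rank distance from
a dominating line (`IsTropicalWith.exists_lacunary`). Splitting the lines by their rank modulo a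
large `N` gives finitely many power series, one of which is dominated at each radius by a single
term (`exists_dominated_splitting`). The sum of these series, as a function of one coordinate, has
the required maximum modulus.

For holomorphic maps on `ℂ^d` the powers `t ^ m` have to be replaced by entire maps `W m` with
values in a fixed finite-dimensional space and `‖W m z‖` comparable to `‖z‖ ^ m` uniformly in `m`
(`HasNormPowers`). These are built by induction on `d` from the same splitting theorem: by an
entropy estimate, `(t² + s²)^(m / 2)` is, up to the factor `e`, the maximum of multiples of the
monomials `t ^ k * s ^ (m - k)` (`exists_tropical_norm_pow`), where `t ^ k` is modelled by the maps
in dimension `d` and `s ^ (m - k)` by a power of the additional coordinate.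
-/

namespace RadialWeight

/-! ### Tropical power series: attained suprema and minimal subfamilies -/

/-- `Ψ` is the pointwise supremum of the lines `x ↦ b j + j x`, `j ∈ E`. -/
def IsTropicalWith (E : Set ℕ) (b : ℕ → ℝ) (Ψ : ℝ → ℝ) : Prop :=
  ∀ x : ℝ, IsLUB ((fun j : ℕ => b j + (j : ℝ) * x) '' E) (Ψ x)

namespace IsTropicalWith

variable {E : Set ℕ} {b : ℕ → ℝ} {Ψ : ℝ → ℝ}

lemma le (h : IsTropicalWith E b Ψ) {j : ℕ} (hj : j ∈ E) (x : ℝ) : b j + j * x ≤ Ψ x :=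
  (h x).1 ⟨j, hj, rfl⟩

/-- Since `Ψ (x + 1)` is finite, only finitely many lines come close to `Ψ` at `x`. -/
lemma finite_near (h : IsTropicalWith E b Ψ) (x A : ℝ) :
    {j ∈ E | Ψ x - A ≤ b j + j * x}.Finite := by
  refine (Set.finite_Iic ⌊Ψ (x + 1) - Ψ x + A⌋₊).subset ?_
  rintro j ⟨hj, hA⟩
  have := h.le hj (x + 1)
  exact Nat.le_floor (by nlinarith)

lemma exists_eq (h : IsTropicalWith E b Ψ) (x : ℝ) : ∃ j ∈ E, b j + j * x = Ψ x := by
  obtain ⟨_, ⟨j₀, hj₀, rfl⟩, hlt, -⟩ := (h x).exists_between (sub_one_lt (Ψ x))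
  obtain ⟨j, ⟨hjE, hj⟩, hmax⟩ := Set.exists_max_image _ (fun j : ℕ => b j + (j : ℝ) * x)
    (h.finite_near x 1) ⟨j₀, hj₀, hlt.le⟩
  refine ⟨j, hjE, le_antisymm (h.le hjE x) ((h x).2 ?_)⟩
  rintro _ ⟨i, hi, rfl⟩
  by_cases hi' : Ψ x - 1 ≤ b i + i * x
  · exact hmax i ⟨hi, hi'⟩
  · exact (not_le.1 hi').le.trans hj

end IsTropicalWith

/-- A set `F` of exponents whose lines all touch the graph of `Ψ` and whose upper envelope is
nowhere more than `1` below `Ψ`. -/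
def IsCover (E : Set ℕ) (b : ℕ → ℝ) (Ψ : ℝ → ℝ) (F : Set ℕ) : Prop :=
  (∀ j ∈ F, j ∈ E ∧ ∃ a, b j + j * a = Ψ a) ∧ ∀ x, ∃ j ∈ F, Ψ x - 1 ≤ b j + j * x

lemma IsTropicalWith.exists_minimal_cover {E : Set ℕ} {b : ℕ → ℝ} {Ψ : ℝ → ℝ}
    (h : IsTropicalWith E b Ψ) : ∃ F, Minimal (IsCover E b Ψ) F := by
  refine (zorn_superset_nonempty {F | IsCover E b Ψ F} ?_
    {j | j ∈ E ∧ ∃ a, b j + j * a = Ψ a} ⟨fun j hj => hj, fun x => ?_⟩).imp fun F hF => hF.2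
  · intro c hc hchain ⟨F₀, hF₀⟩
    refine ⟨⋂₀ c, ⟨fun j hj => (hc hF₀).1 j (hj F₀ hF₀), fun x => ?_⟩,
      fun s hs => Set.sInter_subset_of_mem hs⟩
    -- Otherwise each of the finitely many lines close to `Ψ` at `x` is missing from some member
    -- of the chain, and the smallest of these members does not cover `x`.
    by_contra! hcon
    have key : ∀ S : Finset ℕ, (∀ j ∈ S, Ψ x - 1 ≤ b j + j * x) →
        ∃ G ∈ c, ∀ j ∈ S, j ∉ G := by
      intro S
      induction S using Finset.induction_on with
      | empty => exact fun _ => ⟨F₀, hF₀, by simp⟩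
      | insert j S _ ih =>
        intro hS
        obtain ⟨G, hG, hGS⟩ := ih fun i hi => hS i (Finset.mem_insert_of_mem hi)
        have hj : j ∉ ⋂₀ c := fun hj =>
          absurd (hS j (Finset.mem_insert_self _ _)) (not_le.2 (hcon j hj))
        obtain ⟨H, hH, hjH⟩ : ∃ H ∈ c, j ∉ H := by simpa using hj
        rcases hchain.total hG hH with hGH | hHG
        · refine ⟨G, hG, fun i hi => ?_⟩
          rcases Finset.mem_insert.1 hi with rfl | hi
          · exact fun hi => hjH (hGH hi)
          · exact hGS i hi
        · refine ⟨H, hH, fun i hi => ?_⟩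
          rcases Finset.mem_insert.1 hi with rfl | hi
          · exact hjH
          · exact fun hi' => hGS i hi (hHG hi')
    obtain ⟨G, hG, hGS⟩ := key (h.finite_near x 1).toFinset (by simp)
    obtain ⟨j, hj, hjx⟩ := (hc hG).2 x
    exact hGS j ((h.finite_near x 1).mem_toFinset.2 ⟨((hc hG).1 j hj).1, hjx⟩) hj
  · obtain ⟨j, hj, hjx⟩ := h.exists_eq x
    exact ⟨j, ⟨hj, x, hjx⟩, by linarith⟩

/-- In a minimal cover, lines that are not neighbours are separated at their touching points.
The line between them cannot be removed, so at some point `y` both outer lines are more than `1`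
below `Ψ`; convexity of `Ψ` carries this gap from `y` to the touching points. -/
lemma separated_of_minimal {E : Set ℕ} {b : ℕ → ℝ} {Ψ : ℝ → ℝ} (h : IsTropicalWith E b Ψ)
    {F : Set ℕ} (hF : Minimal (IsCover E b Ψ) F) {a : ℕ → ℝ}
    (ha : ∀ j ∈ F, b j + j * a j = Ψ (a j)) {i m j : ℕ} (hi : i ∈ F) (hm : m ∈ F) (hj : j ∈ F)
    (him : i < m) (hmj : m < j) :
    b i + i * a j < b j + j * a j - 1 ∧ b j + j * a i < b i + i * a i - 1 := by
  have him' : (i : ℝ) < m := by exact_mod_cast him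
  have hmj' : (m : ℝ) < j := by exact_mod_cast hmj
  obtain ⟨y, hy⟩ : ∃ y, ∀ k ∈ F \ {m}, b k + k * y < Ψ y - 1 := by
    by_contra! hcon
    have := hF.2 (y := F \ {m}) ⟨fun k hk => hF.1.1 k hk.1, hcon⟩ Set.sdiff_subset hm
    exact this.2 rfl
  have hyi := hy i ⟨hi, him.ne⟩
  have hyj := hy j ⟨hj, hmj.ne'⟩
  have hym : Ψ y - 1 ≤ b m + m * y := by
    obtain ⟨k, hk, hky⟩ := hF.1.2 y
    by_cases hkm : k = m
    · rwa [hkm] at hky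
    · exact absurd (hy k ⟨hk, hkm⟩) (not_lt.2 hky)
  have hmi := h.le (hF.1.1 m hm).1 (a i)
  have hmj2 := h.le (hF.1.1 m hm).1 (a j)
  rw [← ha i hi] at hmi
  rw [← ha j hj] at hmj2
  have h1 : a i < y := by
    by_contra! hcon
    nlinarith
  have h2 : y < a j := by
    by_contra! hcon
    nlinarith
  obtain ⟨l, hl, hly⟩ := h.exists_eq y
  have hli := h.le hl (a i)
  have hlj := h.le hl (a j)
  rw [← ha i hi] at hli
  rw [← ha j hj] at hlj
  have h3 : (i : ℝ) < l := by
    by_contra! hcon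
    nlinarith
  have h4 : (l : ℝ) < j := by
    by_contra! hcon
    nlinarith
  constructor <;> nlinarith

section Rank

open Classical in
/-- The number of elements of `F` below `j`. -/
noncomputable def rank (F : Set ℕ) (j : ℕ) : ℕ := Nat.count (· ∈ F) j

lemma exists_rank_eq {F : Set ℕ} {k n : ℕ} (h : k < rank F n) : ∃ i ∈ F, i < n ∧ rank F i = k := by
  induction n with
  | zero => simp [rank] at h
  | succ n ih =>
    by_cases hk : k < rank F n
    · obtain ⟨i, hi, hin, hik⟩ := ih hk
      exact ⟨i, hi, by omega, hik⟩
    · by_cases hn : n ∈ F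
      · refine ⟨n, hn, by omega, ?_⟩
        simp only [rank, Nat.count_succ, hn, if_true] at h hk ⊢
        omega
      · simp only [rank, Nat.count_succ, hn, if_false] at h hk ⊢
        omega

lemma rank_mono (F : Set ℕ) : Monotone (rank F) := by
  classical exact Nat.count_monotone _

lemma rank_lt_rank {F : Set ℕ} {i j : ℕ} (hi : i ∈ F) (hij : i < j) : rank F i < rank F j := by
  classical
  have : rank F (i + 1) ≤ rank F j := rank_mono F hij
  simp only [rank, Nat.count_succ, hi, if_true] at this ⊢
  omega

lemma lt_of_rank_lt {F : Set ℕ} {i j : ℕ} (h : rank F i < rank F j) : i < j :=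
  (rank_mono F).reflect_lt h

lemma rank_injOn (F : Set ℕ) : Set.InjOn (rank F) F := fun i hi j hj h => by
  rcases lt_trichotomy i j with hij | hij | hij
  · exact absurd h (rank_lt_rank hi hij).ne
  · exact hij
  · exact absurd h (rank_lt_rank hj hij).ne'

lemma exists_rank_add {F : Set ℕ} {i j s : ℕ} (hj : j ∈ F) (h : rank F i + s ≤ rank F j) :
    ∃ q ∈ F, q ≤ j ∧ rank F q = rank F i + s := by
  rcases h.lt_or_eq with h | h
  · obtain ⟨q, hq, hqj, hr⟩ := exists_rank_eq h
    exact ⟨q, hq, hqj.le, hr⟩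
  · exact ⟨j, hj, le_rfl, h.symm⟩

end Rank

/-- Lines whose non-neighbours are separated by `1` at the points `a j`: every second line to the
right of `i` loses at least `1` on `(-∞, a i]`. -/
lemma decay_right {F : Set ℕ} {b a : ℕ → ℝ}
    (hle : ∀ i ∈ F, ∀ j ∈ F, b j + j * a i ≤ b i + i * a i)
    (hsep : ∀ i ∈ F, ∀ m ∈ F, ∀ j ∈ F, i < m → m < j →
      b i + i * a j < b j + j * a j - 1 ∧ b j + j * a i < b i + i * a i - 1)
    {x : ℝ} (n : ℕ) : ∀ {i j : ℕ}, i ∈ F → j ∈ F → i ≤ j → rank F i + 2 * n ≤ rank F j →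
      x ≤ a i → b j + j * x ≤ b i + i * x - n := by
  induction n with
  | zero =>
    intro i j hi hj hij _ hx
    have hij' : (i : ℝ) ≤ j := by exact_mod_cast hij
    have := hle i hi j hj
    push_cast
    nlinarith
  | succ n ih =>
    intro i j hi hj _ hr hx
    obtain ⟨m, hm, -, hrm⟩ := exists_rank_add (i := i) (s := 1) hj (by omega)
    obtain ⟨q, hq, hqj, hrq⟩ := exists_rank_add (i := i) (s := 2) hj (by omega)
    have him : i < m := lt_of_rank_lt (F := F) (by omega)
    have hmq : m < q := lt_of_rank_lt (F := F) (by omega)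
    have hsp := hsep i hi m hm q hq him hmq
    have hiq : (i : ℝ) < q := by exact_mod_cast him.trans hmq
    have haq : a i ≤ a q := by
      by_contra! hcon
      nlinarith
    have := ih hq hj hqj (by omega) (hx.trans haq)
    push_cast
    nlinarith

/-- Every second line to the left of `j` loses at least `1` on `[a j, ∞)`. -/
lemma decay_left {F : Set ℕ} {b a : ℕ → ℝ}
    (hle : ∀ i ∈ F, ∀ j ∈ F, b j + j * a i ≤ b i + i * a i)
    (hsep : ∀ i ∈ F, ∀ m ∈ F, ∀ j ∈ F, i < m → m < j →
      b i + i * a j < b j + j * a j - 1 ∧ b j + j * a i < b i + i * a i - 1)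
    {x : ℝ} (n : ℕ) : ∀ {i j : ℕ}, i ∈ F → j ∈ F → i ≤ j → rank F i + 2 * n ≤ rank F j →
      a j ≤ x → b i + i * x ≤ b j + j * x - n := by
  induction n with
  | zero =>
    intro i j hi hj hij _ hx
    have hij' : (i : ℝ) ≤ j := by exact_mod_cast hij
    have := hle j hj i hi
    push_cast
    nlinarith
  | succ n ih =>
    intro i j hi hj _ hr hx
    obtain ⟨m, hm, -, hrm⟩ := exists_rank_add (i := i) (s := 2 * n + 1) hj (by omega)
    obtain ⟨q, hq, -, hrq⟩ := exists_rank_add (i := i) (s := 2 * n) hj (by omega)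
    have hqm : q < m := lt_of_rank_lt (F := F) (by omega)
    have hmj : m < j := lt_of_rank_lt (F := F) (by omega)
    have hiq : i ≤ q := by
      by_contra! hcon
      have := rank_lt_rank hq hcon
      omega
    have hsp := hsep q hq m hm j hj hqm hmj
    have hqj : (q : ℝ) < j := by exact_mod_cast hqm.trans hmj
    have haq : a q ≤ a j := by
      by_contra! hcon
      nlinarith
    have := ih hi hq hiq (by omega) (haq.trans hx)
    push_cast
    nlinarith

/-- Every tropical power series has, up to an additive constant, a subfamily of lines which, at
every point, decay linearly in the rank distance from a dominating line. -/
lemma IsTropicalWith.exists_lacunary {E : Set ℕ} {b : ℕ → ℝ} {Ψ : ℝ → ℝ}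
    (h : IsTropicalWith E b Ψ) : ∃ F ⊆ E, ∀ x, ∃ k ∈ F, Ψ x - 1 ≤ b k + k * x ∧
      ∀ j ∈ F, b j + j * x ≤
        Ψ x + 3 / 2 - (((rank F j : ℤ) - (rank F k : ℤ)).natAbs : ℝ) / 2 := by
  obtain ⟨F, hF⟩ := h.exists_minimal_cover
  have hFE : F ⊆ E := fun j hj => (hF.1.1 j hj).1
  have hex : ∀ j, ∃ a, j ∈ F → b j + j * a = Ψ a := fun j => by
    by_cases hj : j ∈ F
    · exact (hF.1.1 j hj).2.imp fun a ha _ => ha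
    · exact ⟨0, fun h => absurd h hj⟩
  choose a ha using hex
  have hle : ∀ i ∈ F, ∀ j ∈ F, b j + j * a i ≤ b i + i * a i := fun i hi j hj =>
    (h.le (hFE hj) _).trans_eq (ha i hi).symm
  have hsep : ∀ i ∈ F, ∀ m ∈ F, ∀ j ∈ F, i < m → m < j →
      b i + i * a j < b j + j * a j - 1 ∧ b j + j * a i < b i + i * a i - 1 :=
    fun i hi m hm j hj him hmj => separated_of_minimal h hF ha hi hm hj him hmj
  refine ⟨F, hFE, fun x => ?_⟩
  obtain ⟨k, hk, hkx⟩ := hF.1.2 x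
  refine ⟨k, hk, hkx, fun j hj => ?_⟩
  have hjx := h.le (hFE hj) x
  rcases le_total (rank F k) (rank F j) with hkj | hkj
  · obtain ⟨s, hs⟩ := Nat.exists_eq_add_of_le hkj
    have e : ((rank F j : ℤ) - (rank F k : ℤ)).natAbs = s := by omega
    rw [e]
    by_cases hs2 : s < 2
    · have : (s : ℝ) ≤ 1 := by exact_mod_cast Nat.lt_succ_iff.1 hs2
      linarith
    obtain ⟨m, hm, -, hrm⟩ := exists_rank_add (i := k) (s := 1) hj (by omega)
    obtain ⟨q, hq, hqj, hrq⟩ := exists_rank_add (i := k) (s := 2) hj (by omega)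
    have hkm : k < m := lt_of_rank_lt (F := F) (by omega)
    have hmq : m < q := lt_of_rank_lt (F := F) (by omega)
    have hsp := (hsep k hk m hm q hq hkm hmq).1
    have hkq : (k : ℝ) < q := by exact_mod_cast hkm.trans hmq
    have hqx := h.le (hFE hq) x
    -- Right of `a q` the line `k` would be more than `1` below `Ψ`.
    have hxq : x ≤ a q := by
      by_contra! hcon
      nlinarith
    have := decay_right hle hsep ((s - 2) / 2) hq hj hqj (by omega) hxq
    have h2 : (s : ℝ) ≤ 2 * ((s - 2) / 2 : ℕ) + 3 := by
      exact_mod_cast (by omega : s ≤ 2 * ((s - 2) / 2) + 3)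
    linarith
  · obtain ⟨s, hs⟩ := Nat.exists_eq_add_of_le hkj
    have e : ((rank F j : ℤ) - (rank F k : ℤ)).natAbs = s := by omega
    rw [e]
    by_cases hs2 : s < 2
    · have : (s : ℝ) ≤ 1 := by exact_mod_cast Nat.lt_succ_iff.1 hs2
      linarith
    obtain ⟨t, rfl⟩ := Nat.exists_eq_add_of_le (not_lt.1 hs2)
    obtain ⟨m, hm, -, hrm⟩ := exists_rank_add (i := j) (s := t + 1) hk (by omega)
    obtain ⟨q, hq, -, hrq⟩ := exists_rank_add (i := j) (s := t) hk (by omega)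
    have hqm : q < m := lt_of_rank_lt (F := F) (by omega)
    have hmk : m < k := lt_of_rank_lt (F := F) (by omega)
    have hjq : j ≤ q := by
      by_contra! hcon
      have := rank_lt_rank hq hcon
      omega
    have hsp := (hsep q hq m hm k hk hqm hmk).2
    have hqk : (q : ℝ) < k := by exact_mod_cast hqm.trans hmk
    have hqx := h.le (hFE hq) x
    have hxq : a q ≤ x := by
      by_contra! hcon
      nlinarith
    have := decay_left hle hsep (t / 2) hj hq hjq (by omega) hxq
    have h2 : ((2 + t : ℕ) : ℝ) ≤ 2 * (t / 2 : ℕ) + 3 := by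
      exact_mod_cast (by omega : 2 + t ≤ 2 * (t / 2) + 3)
    linarith

/-! ### Splitting into finitely many power series with a dominant term -/

/-- The ratio of the geometric series that control the lacunary sums. -/
noncomputable def geomRatio : ℝ := Real.exp (-(1 / 4))

/-- The constant in the upper bound of the lacunary sums. -/
noncomputable def geomConst : ℝ := Real.exp (3 / 2) * ∑' n : ℤ, geomRatio ^ n.natAbs

lemma geomRatio_pos : 0 < geomRatio := Real.exp_pos _

lemma geomRatio_lt_one : geomRatio < 1 := by
  rw [geomRatio, Real.exp_lt_one_iff]; norm_num

lemma summable_geomRatio : Summable fun n : ℤ => geomRatio ^ n.natAbs := by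
  apply Summable.of_nat_of_neg <;>
  simpa using summable_geometric_of_lt_one geomRatio_pos.le geomRatio_lt_one

lemma geomConst_pos : 0 < geomConst :=
  mul_pos (Real.exp_pos _) (summable_geomRatio.tsum_pos (fun _ => by positivity [geomRatio_pos]) 0
    (by simp))

/-- The coefficients of a tropical power series can be restricted to finitely many (`N`) families
so that each of the resulting power series is `O(e^Ψ)`, and at each point one of them has a term
of size at least `e^(Ψ - 1)` which exceeds the sum of the other terms of the same family up to a
prescribed precision. Here `N` depends on the precision only. -/
theorem exists_dominated_splitting {ε : ℝ} (hε : 0 < ε) : ∃ N : ℕ, ∀ (E : Set ℕ) (b : ℕ → ℝ)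
    (Ψ : ℝ → ℝ), IsTropicalWith E b Ψ → ∃ β : Fin N → ℕ → ℝ, (∀ c j, 0 ≤ β c j) ∧
      (∀ c j, j ∉ E → β c j = 0) ∧ ∀ t : ℝ, 0 < t → (∀ c, Summable fun j => β c j * t ^ j) ∧
        (∀ c, ∑' j, β c j * t ^ j ≤ geomConst * Real.exp (Ψ (Real.log t))) ∧
        ∃ c k, Real.exp (-1) * Real.exp (Ψ (Real.log t)) ≤ β c k * t ^ k ∧
          ∑' j, β c j * t ^ j - β c k * t ^ k ≤ ε * Real.exp (Ψ (Real.log t)) := by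
  classical
  obtain ⟨N, hN⟩ := exists_pow_lt_of_lt_one (div_pos hε geomConst_pos) geomRatio_lt_one
  have hp0 := geomRatio_pos
  have hp1 := geomRatio_lt_one
  refine ⟨N + 1, fun E b Ψ h => ?_⟩
  obtain ⟨F, hFE, hF⟩ := h.exists_lacunary
  refine ⟨fun c j => if j ∈ F ∧ rank F j % (N + 1) = c then Real.exp (b j) else 0,
    fun c j => by dsimp only; split_ifs <;> positivity,
    fun c j hj => if_neg fun hj' => hj (hFE hj'.1), fun t ht => ?_⟩
  set x := Real.log t
  have hexp : ∀ j : ℕ, Real.exp (b j) * t ^ j = Real.exp (b j + j * x) := fun j => by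
    rw [Real.exp_add, Real.exp_nat_mul, Real.exp_log ht]
  obtain ⟨k, hk, hkx, hdec⟩ := hF x
  let D : ℕ → ℕ := fun j => ((rank F j : ℤ) - (rank F k : ℤ)).natAbs
  have hterm : ∀ j ∈ F, Real.exp (b j) * t ^ j ≤
      Real.exp (3 / 2) * Real.exp (Ψ x) * (geomRatio ^ D j * geomRatio ^ D j) := fun j hj => by
    rw [hexp, geomRatio, ← Real.exp_nat_mul, ← Real.exp_add, ← Real.exp_add, ← Real.exp_add]
    refine Real.exp_le_exp.2 ((hdec j hj).trans (le_of_eq ?_))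
    simp only [D]
    ring
  -- Distinct elements of `F` have distinct ranks.
  let g : ℕ → ℝ := fun j => if j ∈ F then geomRatio ^ D j else 0
  have hg0 : ∀ j, 0 ≤ g j := fun j => by dsimp only [g]; split_ifs <;> positivity
  have hinj : Function.Injective fun j : F => (rank F j : ℤ) - (rank F k : ℤ) := fun i j hij =>
    Subtype.ext (rank_injOn F i.2 j.2 (by simpa using hij))
  have hgF : g = F.indicator fun j => geomRatio ^ D j := by
    ext j; simp [g, Set.indicator_apply]
  have hgsum : Summable g := by
    rw [hgF, ← summable_subtype_iff_indicator]
    exact summable_geomRatio.comp_injective hinj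
  have hgtsum : ∑' j, g j ≤ ∑' n : ℤ, geomRatio ^ n.natAbs := by
    rw [hgF, ← tsum_subtype]
    exact tsum_comp_le_tsum_of_inj summable_geomRatio (fun _ => by positivity) hinj
  have hle : ∀ (c : Fin (N + 1)) j, (if j ∈ F ∧ rank F j % (N + 1) = c then Real.exp (b j) else 0)
      * t ^ j ≤ Real.exp (3 / 2) * Real.exp (Ψ x) * g j := fun c j => by
    split_ifs with hj
    · refine (hterm j hj.1).trans ?_
      simp only [g, hj.1, if_true]
      gcongr
      exact mul_le_of_le_one_left (by positivity) (pow_le_one₀ hp0.le hp1.le)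
    · rw [zero_mul]
      exact mul_nonneg (by positivity) (hg0 j)
  have hsum : ∀ c : Fin (N + 1), Summable fun j =>
      (if j ∈ F ∧ rank F j % (N + 1) = c then Real.exp (b j) else 0) * t ^ j := fun c =>
    Summable.of_nonneg_of_le (fun j => by split_ifs <;> positivity) (hle c) (hgsum.mul_left _)
  refine ⟨hsum, fun c => ?_, ⟨rank F k % (N + 1), Nat.mod_lt _ N.succ_pos⟩, k, ?_, ?_⟩
  · refine ((hsum c).tsum_le_tsum (hle c) (hgsum.mul_left _)).trans ?_
    rw [tsum_mul_left, geomConst]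
    calc _ ≤ Real.exp (3 / 2) * Real.exp (Ψ x) * ∑' n : ℤ, geomRatio ^ n.natAbs := by gcongr
      _ = _ := by ring
  · simp only [hk, true_and, if_true]
    rw [hexp, ← Real.exp_add]
    exact Real.exp_le_exp.2 (by linarith)
  · rw [sub_le_iff_le_add', ← sub_le_iff_le_add', (hsum _).tsum_eq_add_tsum_ite k,
      add_sub_cancel_left]
    refine (Summable.tsum_le_tsum (g := fun j => geomRatio ^ N *
      (Real.exp (3 / 2) * Real.exp (Ψ x)) * g j) (fun j => ?_) ?_ (hgsum.mul_left _)).trans ?_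
    · split_ifs with hjk hj
      · exact mul_nonneg (by positivity) (hg0 j)
      · refine (hterm j hj.1).trans ?_
        simp only [g, hj.1, if_true]
        -- Two different elements of one class have rank distance at least `N + 1`.
        have hD : N ≤ D j := by
          have hne : rank F j ≠ rank F k := fun h' => hjk (rank_injOn F hj.1 hk h')
          have hmod : (N + 1 : ℤ) ∣ (rank F j : ℤ) - (rank F k : ℤ) := by
            have := (Nat.modEq_iff_dvd (n := N + 1) (a := rank F k) (b := rank F j)).1 hj.2.symm
            exact_mod_cast this
          have := Int.natAbs_dvd_natAbs.2 hmod
          have h3 := Nat.le_of_dvd (Int.natAbs_pos.2 (by omega)) this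
          simp only [D]
          omega
        calc _ ≤ Real.exp (3 / 2) * Real.exp (Ψ x) * (geomRatio ^ N * geomRatio ^ D j) := by
              gcongr Real.exp (3 / 2) * Real.exp (Ψ x) * (?_ * _)
              exact pow_le_pow_of_le_one hp0.le hp1.le hD
          _ = _ := by ring
      · rw [zero_mul]
        exact mul_nonneg (by positivity) (hg0 j)
    · refine Summable.of_nonneg_of_le (fun j => ?_) (fun j => ?_) (hsum
        ⟨rank F k % (N + 1), Nat.mod_lt _ N.succ_pos⟩)
      · dsimp only; split_ifs <;> positivity
      · dsimp only; split_ifs <;> first | positivity | exact le_rfl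
    · rw [tsum_mul_left]
      have : geomRatio ^ N * geomConst ≤ ε := ((lt_div_iff₀ geomConst_pos).1 hN).le
      calc _ ≤ geomRatio ^ N * (Real.exp (3 / 2) * Real.exp (Ψ x)) *
            ∑' n : ℤ, geomRatio ^ n.natAbs := by gcongr
        _ = geomRatio ^ N * geomConst * Real.exp (Ψ x) := by rw [geomConst]; ring
        _ ≤ _ := by gcongr

/-! ### Holomorphic sums of power-series type -/

/-- A series of entire maps dominated by an entire power series in `‖z‖` is entire; the derivatives
are dominated by Cauchy's estimate on complex lines. -/
lemma differentiable_tsum_of_norm_le {X V : Type*} [NormedAddCommGroup X] [NormedSpace ℂ X]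
    [NormedAddCommGroup V] [NormedSpace ℂ V] [CompleteSpace V] {f : ℕ → X → V} {β : ℕ → ℝ}
    (hβ : ∀ j, 0 ≤ β j) (hs : ∀ t : ℝ, 0 < t → Summable fun j => β j * t ^ j)
    (hf : ∀ j, Differentiable ℂ (f j)) (hle : ∀ j z, ‖f j z‖ ≤ β j * ‖z‖ ^ j) :
    Differentiable ℂ fun z => ∑' j, f j z := by
  intro z₀
  have hR : 0 < ‖z₀‖ + 1 := by positivity
  have hmem : z₀ ∈ Metric.ball (0 : X) (‖z₀‖ + 1) := by simp
  refine (hasFDerivAt_tsum_of_isPreconnected (hs (‖z₀‖ + 2) (by positivity)) Metric.isOpen_ball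
    (convex_ball (0 : X) _).isPreconnected (fun j x _ => (hf j x).hasFDerivAt) ?_ hmem ?_
    hmem).differentiableAt
  · intro j x hx
    refine ContinuousLinearMap.opNorm_le_bound _
      (mul_nonneg (hβ j) (by positivity)) fun v => ?_
    rcases eq_or_ne v 0 with rfl | hv
    · simp
    have hv' : 0 < ‖v‖ := norm_pos_iff.2 hv
    have hd : HasDerivAt (fun l : ℂ => x + l • v) v 0 := by
      simpa using ((hasDerivAt_id (0 : ℂ)).smul_const v).const_add x
    have hg : HasDerivAt (fun l : ℂ => f j (x + l • v)) (fderiv ℂ (f j) x v) 0 := by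
      have h1 : HasFDerivAt (f j) (fderiv ℂ (f j) x) (x + (0 : ℂ) • v) := by
        simpa using (hf j x).hasFDerivAt
      exact h1.comp_hasDerivAt (0 : ℂ) hd
    have hgd : Differentiable ℂ fun l : ℂ => f j (x + l • v) :=
      (hf j).comp ((differentiable_id.smul_const v).const_add x)
    have := Complex.norm_deriv_le_of_forall_mem_sphere_norm_le (c := 0)
      (C := β j * (‖z₀‖ + 2) ^ j) (inv_pos.2 hv') hgd.diffContOnCl fun l hl => by
        refine (hle j _).trans ?_
        have hl' : ‖l‖ = ‖v‖⁻¹ := by simpa using hl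
        have hx' : ‖x‖ < ‖z₀‖ + 1 := by simpa using hx
        have : ‖x + l • v‖ ≤ ‖z₀‖ + 2 := by
          refine (norm_add_le _ _).trans ?_
          rw [norm_smul, hl', inv_mul_cancel₀ hv'.ne']
          linarith
        have := hβ j
        gcongr
    rwa [hg.deriv, div_inv_eq_mul] at this
  · exact Summable.of_norm_bounded (hs (‖z₀‖ + 1) hR) fun j => (hle j z₀).trans <| by
      have := hβ j
      gcongr
      linarith

/-- Vector-valued form of `exists_dominated_splitting`: the powers `t ^ j` may be replaced by
vectors of comparable norm. -/
lemma exists_splitting_vector {δ : ℝ} (hδ : 0 < δ) : ∃ N : ℕ, ∀ (E : Set ℕ) (b : ℕ → ℝ)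
    (Ψ : ℝ → ℝ), IsTropicalWith E b Ψ → ∃ β : Fin N → ℕ → ℝ, (∀ c j, 0 ≤ β c j) ∧
      (∀ c j, j ∉ E → β c j = 0) ∧
      (∀ t : ℝ, 0 < t → ∀ c, Summable fun j => β c j * t ^ j) ∧
      ∀ (V : Type) [NormedAddCommGroup V] [NormedSpace ℂ V] [CompleteSpace V] (t : ℝ) (u : ℕ → V),
        0 < t → (∀ j, δ * t ^ j ≤ ‖u j‖ ∧ ‖u j‖ ≤ t ^ j) →
        ‖fun c : Fin N => ∑' j, (β c j : ℂ) • u j‖ ≤ geomConst * Real.exp (Ψ (Real.log t)) ∧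
        δ * Real.exp (-1) / 2 * Real.exp (Ψ (Real.log t)) ≤
          ‖fun c : Fin N => ∑' j, (β c j : ℂ) • u j‖ := by
  obtain ⟨N, hN⟩ := exists_dominated_splitting (ε := δ * Real.exp (-1) / 2) (by positivity)
  refine ⟨N, fun E b Ψ h => ?_⟩
  obtain ⟨β, hβ, hβE, hmain⟩ := hN E b Ψ h
  refine ⟨β, hβ, hβE, fun t ht => (hmain t ht).1, fun V _ _ _ t u ht hu => ?_⟩
  obtain ⟨hs, hup, c, k, hk, hrest⟩ := hmain t ht
  have hle : ∀ c j, ‖(β c j : ℂ) • u j‖ ≤ β c j * t ^ j := fun c j => by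
    rw [norm_smul, Complex.norm_real, Real.norm_of_nonneg (hβ c j)]
    exact mul_le_mul_of_nonneg_left (hu j).2 (hβ c j)
  have hsV : ∀ c, Summable fun j => (β c j : ℂ) • u j := fun c =>
    Summable.of_norm_bounded (hs c) (hle c)
  constructor
  · refine (pi_norm_le_iff_of_nonneg ?_).2 fun c => ?_
    · exact mul_nonneg geomConst_pos.le (Real.exp_pos _).le
    · exact (tsum_of_norm_bounded (hs c).hasSum (hle c)).trans (hup c)
  · refine le_trans ?_ (norm_le_pi_norm (fun c : Fin N => ∑' j, (β c j : ℂ) • u j) c)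
    have h1 := (hsV c).tsum_eq_add_tsum_ite k
    have h2 : ‖∑' j, if j = k then 0 else (β c j : ℂ) • u j‖ ≤
        ∑' j, β c j * t ^ j - β c k * t ^ k := by
      have h3 : HasSum (fun j => if j = k then 0 else β c j * t ^ j)
          (∑' j, β c j * t ^ j - β c k * t ^ k) := by
        rw [(hs c).tsum_eq_add_tsum_ite k, add_sub_cancel_left]
        refine Summable.hasSum (Summable.of_nonneg_of_le (fun j => ?_) (fun j => ?_) (hs c))
        · have := hβ c j
          split_ifs <;> positivity
        · have := hβ c j
          split_ifs
          · positivity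
          · exact le_rfl
      refine tsum_of_norm_bounded h3 fun j => ?_
      split_ifs
      · simp
      · exact hle c j
    have h4 : δ * (Real.exp (-1) * Real.exp (Ψ (Real.log t))) ≤ ‖(β c k : ℂ) • u k‖ := by
      rw [norm_smul, Complex.norm_real, Real.norm_of_nonneg (hβ c k)]
      calc _ ≤ δ * (β c k * t ^ k) := by gcongr
        _ = β c k * (δ * t ^ k) := by ring
        _ ≤ _ := mul_le_mul_of_nonneg_left (hu k).1 (hβ c k)
    rw [h1]
    have h5 := norm_sub_le_norm_add ((β c k : ℂ) • u k)
      (∑' j, if j = k then 0 else (β c j : ℂ) • u j)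
    linarith

/-! ### The tropical power series of a power of the Euclidean norm -/

/-- `m` times the entropy of the two-point distribution `(k / m, 1 - k / m)`. -/
noncomputable def binEntropy (m k : ℕ) : ℝ :=
  -(k * Real.log (k / m) + (m - k : ℝ) * Real.log ((m - k : ℝ) / m))

lemma mul_log_sub_log_le {k M q : ℝ} (hk : 0 ≤ k) (hM : 0 < M) (hq : 0 < q) :
    k * (Real.log q - Real.log (k / M)) ≤ M * q - k := by
  rcases hk.eq_or_lt with rfl | hk
  · simp only [zero_mul, sub_zero]; positivity
  · have h := Real.log_le_sub_one_of_pos (show 0 < q / (k / M) by positivity)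
    rw [Real.log_div hq.ne' (by positivity)] at h
    calc _ ≤ k * (q / (k / M) - 1) := by gcongr
      _ = _ := by field_simp

lemma mul_log_sub_log_le' {k M q : ℝ} (hk : 0 ≤ k) (hM : 0 < M) (hq : 0 < q) :
    k * (Real.log (k / M) - Real.log q) ≤ k ^ 2 / (M * q) - k := by
  rcases hk.eq_or_lt with rfl | hk
  · simp
  · have h := Real.log_le_sub_one_of_pos (show 0 < (k / M) / q by positivity)
    rw [Real.log_div (by positivity) hq.ne'] at h
    calc _ ≤ k * (k / M / q - 1) := by gcongr
      _ = _ := by field_simp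

lemma binEntropy_add_le {m k : ℕ} (hkm : k ≤ m) {q : ℝ} (hq0 : 0 < q) (hq1 : q < 1) :
    binEntropy m k + k * Real.log q + (m - k : ℝ) * Real.log (1 - q) ≤ 0 := by
  rcases Nat.eq_zero_or_pos m with rfl | hm
  · obtain rfl : k = 0 := by omega
    simp [binEntropy]
  have hkm' : (k : ℝ) ≤ m := by exact_mod_cast hkm
  have hm' : (0 : ℝ) < m := by exact_mod_cast hm
  have h1 := mul_log_sub_log_le (k := k) (by positivity) hm' hq0
  have h2 := mul_log_sub_log_le (k := (m - k : ℝ)) (by linarith) hm' (sub_pos.2 hq1)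
  rw [binEntropy]
  linarith

/-- The relative entropy is bounded by the `χ²`-distance. -/
lemma le_binEntropy_add {m k : ℕ} (hkm : k ≤ m) {q : ℝ} (hq0 : 0 < q) (hq1 : q < 1)
    (h : (k - m * q) ^ 2 ≤ 2 * (m * q * (1 - q))) :
    -2 ≤ binEntropy m k + k * Real.log q + (m - k : ℝ) * Real.log (1 - q) := by
  rcases Nat.eq_zero_or_pos m with rfl | hm
  · obtain rfl : k = 0 := by omega
    simp [binEntropy]
  have hkm' : (k : ℝ) ≤ m := by exact_mod_cast hkm
  have hm' : (0 : ℝ) < m := by exact_mod_cast hm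
  have hq1' := sub_pos.2 hq1
  have h1 := mul_log_sub_log_le' (k := k) (by positivity) hm' hq0
  have h2 := mul_log_sub_log_le' (k := (m - k : ℝ)) (by linarith) hm' hq1'
  have h3 : (k : ℝ) ^ 2 / (m * q) - k + ((m - k : ℝ) ^ 2 / (m * (1 - q)) - (m - k)) =
      (k - m * q) ^ 2 / (m * q * (1 - q)) := by
    field_simp
    ring
  have h4 : (k - m * q) ^ 2 / (m * q * (1 - q)) ≤ 2 :=
    (div_le_iff₀ (by positivity)).2 h
  rw [binEntropy]
  linarith

lemma exists_le_binEntropy_add (m : ℕ) {q : ℝ} (hq0 : 0 < q) (hq1 : q < 1) : ∃ k ≤ m,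
    -2 ≤ binEntropy m k + k * Real.log q + (m - k : ℝ) * Real.log (1 - q) := by
  -- For `q ≤ 1 / 2` round `m q` down.
  have key : ∀ q : ℝ, 0 < q → q ≤ 1 / 2 →
      ∃ k ≤ m, ((k : ℝ) - m * q) ^ 2 ≤ 2 * (m * q * (1 - q)) := by
    intro q hq hq2
    have hmq : 0 ≤ m * q := by positivity
    refine ⟨⌊m * q⌋₊, ?_, ?_⟩
    · refine Nat.floor_le_of_le ?_
      have : (0 : ℝ) ≤ m := by positivity
      nlinarith
    · have h1 := Nat.floor_le hmq
      have h2 := Nat.lt_floor_add_one (m * q)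
      have h3 : ((⌊m * q⌋₊ : ℝ) - m * q) ^ 2 ≤ m * q := by
        rcases lt_or_ge (m * q) 1 with h | h
        · rw [Nat.floor_eq_zero.2 h]
          push_cast
          nlinarith
        · nlinarith
      nlinarith
  rcases le_total q (1 / 2) with h | h
  · obtain ⟨k, hk, hkq⟩ := key q hq0 h
    exact ⟨k, hk, le_binEntropy_add hk hq0 hq1 hkq⟩
  · obtain ⟨k, hk, hkq⟩ := key (1 - q) (by linarith) (by linarith)
    refine ⟨m - k, Nat.sub_le _ _, le_binEntropy_add (Nat.sub_le _ _) hq0 hq1 ?_⟩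
    rw [Nat.cast_sub hk]
    linarith

/-- Up to the factor `e`, the power `(t² + s²)^(m / 2)` is the maximum of multiples of the
monomials `t ^ k * s ^ (m - k)`. -/
lemma exists_tropical_norm_pow (m : ℕ) : ∃ (b : ℕ → ℝ) (Ψ : ℝ → ℝ),
    IsTropicalWith {k | k ≤ m} b Ψ ∧ ∀ t s R : ℝ, 0 < t → 0 < s → 0 < R → R ^ 2 = t ^ 2 + s ^ 2 →
      Real.exp (-1) * R ^ m ≤ s ^ m * Real.exp (Ψ (Real.log (t / s))) ∧
      s ^ m * Real.exp (Ψ (Real.log (t / s))) ≤ R ^ m := by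
  set b : ℕ → ℝ := fun k => binEntropy m k / 2
  set Ψ : ℝ → ℝ := fun x => sSup ((fun j : ℕ => b j + (j : ℝ) * x) '' {k | k ≤ m})
  have hΨ : IsTropicalWith {k | k ≤ m} b Ψ := fun x =>
    isLUB_csSup ⟨_, 0, Nat.zero_le m, rfl⟩ ((Set.finite_Iic m).image _).bddAbove
  refine ⟨b, Ψ, hΨ, fun t s R ht hs hR hRts => ?_⟩
  have hq0 : 0 < t ^ 2 / R ^ 2 := by positivity
  have hq1 : t ^ 2 / R ^ 2 < 1 := (div_lt_one (by positivity)).2 (by nlinarith)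
  have hline : ∀ k : ℕ, b k + k * Real.log (t / s) + m * Real.log s =
      (binEntropy m k + k * Real.log (t ^ 2 / R ^ 2) +
        (m - k : ℝ) * Real.log (1 - t ^ 2 / R ^ 2)) / 2 + m * Real.log R := fun k => by
    have h1 : 1 - t ^ 2 / R ^ 2 = s ^ 2 / R ^ 2 := by
      field_simp
      linarith
    rw [h1, Real.log_div ht.ne' hs.ne', Real.log_div (by positivity) (by positivity),
      Real.log_div (by positivity) (by positivity), Real.log_pow, Real.log_pow, Real.log_pow]
    simp only [b]
    push_cast
    ring
  have hpow : ∀ y : ℝ, 0 < y → y ^ m = Real.exp (m * Real.log y) := fun y hy => by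
    rw [Real.exp_nat_mul, Real.exp_log hy]
  rw [hpow R hR, hpow s hs, ← Real.exp_add, ← Real.exp_add, Real.exp_le_exp, Real.exp_le_exp]
  constructor
  · obtain ⟨k, hk, hkq⟩ := exists_le_binEntropy_add m hq0 hq1
    have := hΨ.le hk (Real.log (t / s))
    linarith [hline k]
  · obtain ⟨k, hk, hkx⟩ := hΨ.exists_eq (Real.log (t / s))
    have := binEntropy_add_le hk hq0 hq1
    linarith [hline k]

/-! ### Entire maps whose norms are comparable to powers of the Euclidean norm -/

/-- There are entire maps on `ℂ^d`, one for each degree `m`, with values in a common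
finite-dimensional space, whose norms are comparable to `‖z‖ ^ m` uniformly in `m`. -/
def HasNormPowers (d : ℕ) : Prop :=
  ∃ (V : Type) (_ : NormedAddCommGroup V) (_ : NormedSpace ℂ V) (_ : FiniteDimensional ℂ V)
    (δ : ℝ), 0 < δ ∧ ∀ m : ℕ, ∃ W : Cd d → V, Differentiable ℂ W ∧
      ∀ z, δ * ‖z‖ ^ m ≤ ‖W z‖ ∧ ‖W z‖ ≤ ‖z‖ ^ m

lemma dense_forall_ne_zero (d : ℕ) : Dense {z : Cd d | ∀ i, z i ≠ 0} := by
  have h : Dense (Set.univ.pi fun _ : Fin d => ({0}ᶜ : Set ℂ)) :=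
    dense_pi _ fun _ _ => dense_compl_singleton 0
  convert h.preimage (EuclideanSpace.equiv (Fin d) ℂ).toHomeomorph.isOpenMap using 1
  ext z
  simp

lemma le_of_forall_ne_zero {d : ℕ} {f g : Cd d → ℝ} (hf : Continuous f) (hg : Continuous g)
    (h : ∀ z, (∀ i, z i ≠ 0) → f z ≤ g z) (z : Cd d) : f z ≤ g z :=
  (isClosed_le hf hg).closure_subset_iff.2 h (dense_forall_ne_zero d z)

lemma ne_zero_of_forall {d : ℕ} (hd : 1 ≤ d) {z : Cd d} (hz : ∀ i, z i ≠ 0) : z ≠ 0 := by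
  rintro rfl
  exact hz ⟨0, hd⟩ rfl

lemma hasNormPowers_one : HasNormPowers 1 := by
  refine ⟨ℂ, inferInstance, inferInstance, inferInstance, 1, one_pos, fun m =>
    ⟨fun z => z 0 ^ m, ?_, fun z => ?_⟩⟩
  · fun_prop
  · have : ‖z‖ = ‖z 0‖ := by simp [EuclideanSpace.norm_eq]
    rw [norm_pow, this]
    simp

/-- The last coordinates of a point of `ℂ^(d+1)`. -/
noncomputable def tail {d : ℕ} (z : Cd (d + 1)) : Cd d := WithLp.toLp 2 fun i => z i.succ

lemma differentiable_tail (d : ℕ) : Differentiable ℂ (tail : Cd (d + 1) → Cd d) := by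
  refine differentiable_euclidean.2 fun i => ?_
  simp only [tail]
  fun_prop

lemma norm_sq_eq_tail {d : ℕ} (z : Cd (d + 1)) : ‖z‖ ^ 2 = ‖tail z‖ ^ 2 + ‖z 0‖ ^ 2 := by
  rw [EuclideanSpace.norm_sq_eq, EuclideanSpace.norm_sq_eq, Fin.sum_univ_succ, add_comm]
  rfl

lemma hasNormPowers_succ {d : ℕ} (hd : 1 ≤ d) (h : HasNormPowers d) : HasNormPowers (d + 1) := by
  obtain ⟨V, _, _, _, δ, hδ, hW⟩ := h
  choose W hWd hW using hW
  have : CompleteSpace V := FiniteDimensional.complete ℂ V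
  obtain ⟨N, hN⟩ := exists_splitting_vector hδ
  have hK := geomConst_pos
  refine ⟨Fin N → V, inferInstance, inferInstance, inferInstance,
    geomConst⁻¹ * (δ * Real.exp (-1) / 2 * Real.exp (-1)), by positivity, fun m => ?_⟩
  obtain ⟨b, Ψ, hΨ, hm⟩ := exists_tropical_norm_pow m
  obtain ⟨β, hβ, hβE, -, hmain⟩ := hN _ b Ψ hΨ
  set G : Cd (d + 1) → Fin N → V := fun z c =>
    ∑ k ∈ Finset.range (m + 1), ((β c k : ℂ) * z 0 ^ (m - k)) • W k (tail z)
  have hG : Differentiable ℂ G := by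
    refine differentiable_pi.2 fun c => Differentiable.fun_sum fun k _ => ?_
    have := (hWd k).comp (differentiable_tail d)
    exact Differentiable.smul (by fun_prop) this
  have hgood : ∀ z, (∀ i, z i ≠ 0) → δ * Real.exp (-1) / 2 * Real.exp (-1) * ‖z‖ ^ m ≤ ‖G z‖ ∧
      ‖G z‖ ≤ geomConst * ‖z‖ ^ m := by
    intro z hz
    have hs : 0 < ‖z 0‖ := norm_pos_iff.2 (hz 0)
    have ht : 0 < ‖tail z‖ := norm_pos_iff.2 (ne_zero_of_forall hd fun i => hz i.succ)
    have hR : 0 < ‖z‖ := norm_pos_iff.2 (ne_zero_of_forall (by omega) hz)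
    obtain ⟨h1, h2⟩ := hm _ _ _ ht hs hR (norm_sq_eq_tail z)
    obtain ⟨h3, h4⟩ := hmain V (‖tail z‖ / ‖z 0‖) (fun k => (z 0 ^ k)⁻¹ • W k (tail z))
      (by positivity) fun k => by
        rw [norm_smul, norm_inv, norm_pow, div_pow, div_eq_inv_mul, mul_left_comm]
        exact ⟨mul_le_mul_of_nonneg_left (hW k _).1 (by positivity),
          mul_le_mul_of_nonneg_left (hW k _).2 (by positivity)⟩
    have hGz : G z = z 0 ^ m • fun c => ∑' k, (β c k : ℂ) • (z 0 ^ k)⁻¹ • W k (tail z) := by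
      ext c
      simp only [G, Pi.smul_apply]
      rw [tsum_eq_sum (s := Finset.range (m + 1)), Finset.smul_sum]
      · refine Finset.sum_congr rfl fun k hk => ?_
        have hk' : k ≤ m := Nat.lt_succ_iff.1 (Finset.mem_range.1 hk)
        rw [smul_smul, smul_smul, pow_sub₀ _ (hz 0) hk']
        ring_nf
      · intro k hk
        rw [hβE c k fun hk' : k ≤ m => hk (Finset.mem_range.2 (Nat.lt_succ_iff.2 hk'))]
        simp
    rw [hGz, norm_smul, norm_pow]
    constructor
    · calc _ = δ * Real.exp (-1) / 2 * (Real.exp (-1) * ‖z‖ ^ m) := by ring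
        _ ≤ δ * Real.exp (-1) / 2 *
            (‖z 0‖ ^ m * Real.exp (Ψ (Real.log (‖tail z‖ / ‖z 0‖)))) := by gcongr
        _ = ‖z 0‖ ^ m *
            (δ * Real.exp (-1) / 2 * Real.exp (Ψ (Real.log (‖tail z‖ / ‖z 0‖)))) := by ring
        _ ≤ _ := by gcongr
    · calc _ ≤ ‖z 0‖ ^ m * (geomConst * Real.exp (Ψ (Real.log (‖tail z‖ / ‖z 0‖)))) := by gcongr
        _ = geomConst * (‖z 0‖ ^ m * Real.exp (Ψ (Real.log (‖tail z‖ / ‖z 0‖)))) := by ring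
        _ ≤ _ := by gcongr
  have hall : ∀ z, δ * Real.exp (-1) / 2 * Real.exp (-1) * ‖z‖ ^ m ≤ ‖G z‖ ∧
      ‖G z‖ ≤ geomConst * ‖z‖ ^ m := by
    have hGc := hG.continuous
    exact fun z => ⟨le_of_forall_ne_zero (by fun_prop) (by fun_prop) (fun z hz => (hgood z hz).1) z,
      le_of_forall_ne_zero (by fun_prop) (by fun_prop) (fun z hz => (hgood z hz).2) z⟩
  refine ⟨fun z => ((geomConst⁻¹ : ℝ) : ℂ) • G z, by fun_prop, fun z => ?_⟩
  rw [norm_smul, Complex.norm_real, Real.norm_of_nonneg (by positivity)]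
  constructor
  · rw [mul_assoc]
    have := (hall z).1
    gcongr
  · rw [inv_mul_le_iff₀ hK]
    exact (hall z).2

lemma hasNormPowers {d : ℕ} (hd : 1 ≤ d) : HasNormPowers d :=
  Nat.le_induction hasNormPowers_one (fun _ hn ih => hasNormPowers_succ hn ih) d hd

/-! ### Log-tropical weights are approximable -/

lemma exp_logTransform {v : ℝ≥0 → ℝ} (hv : IsWeight v) {t : ℝ≥0} (ht : 0 < t) :
    Real.exp (logTransform v (Real.log t)) = v t := by
  rw [logTransform, Real.exp_log (hv.pos _), Real.exp_log (NNReal.coe_pos.2 ht), Real.toNNReal_coe]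

lemma Equivalent.trans {X : Type*} {u v w : X → ℝ} (h : Equivalent u v) (h' : Equivalent v w) :
    Equivalent u w := by
  obtain ⟨C₁, C₂, h₁, h₂, h⟩ := h
  obtain ⟨D₁, D₂, k₁, k₂, k⟩ := h'
  refine ⟨D₁ * C₁, D₂ * C₂, by positivity, by positivity, fun x => ⟨?_, ?_⟩⟩
  · rw [mul_assoc]
    exact (mul_le_mul_of_nonneg_left (h x).1 k₁.le).trans (k x).1
  · rw [mul_assoc]
    exact (k x).2.trans (mul_le_mul_of_nonneg_left (h x).2 k₂.le)

lemma Equivalent.symm {X : Type*} {u v : X → ℝ} (h : Equivalent u v) : Equivalent v u := by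
  obtain ⟨C₁, C₂, h₁, h₂, h⟩ := h
  refine ⟨C₂⁻¹, C₁⁻¹, by positivity, by positivity, fun x => ⟨?_, ?_⟩⟩
  · rw [inv_mul_le_iff₀ h₂]
    exact (h x).2
  · rw [le_inv_mul_iff₀ h₁]
    exact (h x).1

lemma Equivalent.comp {X Y : Type*} {u v : X → ℝ} (h : Equivalent u v) (φ : Y → X) :
    Equivalent (u ∘ φ) (v ∘ φ) := by
  obtain ⟨C₁, C₂, h₁, h₂, h⟩ := h
  exact ⟨C₁, C₂, h₁, h₂, fun x => h (φ x)⟩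

lemma continuous_radial {d : ℕ} {v : ℝ≥0 → ℝ} (hv : IsWeight v) : Continuous (radial d v) :=
  hv.cont.comp continuous_nnnorm

theorem isApproximable_of_isTropicallyEquivalent {w : ℝ≥0 → ℝ} (h : IsTropicallyEquivalent w)
    {d : ℕ} (hd : 1 ≤ d) : IsApproximable d w := by
  obtain ⟨v, hv, ⟨E, b, hE⟩, hwv⟩ := h
  obtain ⟨V, _, _, _, δ, hδ, hW⟩ := hasNormPowers hd
  choose W hWd hW using hW
  have : CompleteSpace V := FiniteDimensional.complete ℂ V
  obtain ⟨N, hN⟩ := exists_splitting_vector hδ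
  obtain ⟨β, hβ, -, hs, hmain⟩ := hN E b (logTransform v) hE
  have hK := geomConst_pos
  set G : Cd d → Fin N → V := fun z c => ∑' j, (β c j : ℂ) • W j z
  have hG : Differentiable ℂ G := by
    refine differentiable_pi.2 fun c => differentiable_tsum_of_norm_le (hβ c)
      (fun t ht => hs t ht c) (fun j => (hWd j).const_smul _) fun j z => ?_
    rw [norm_smul, Complex.norm_real, Real.norm_of_nonneg (hβ c j)]
    exact mul_le_mul_of_nonneg_left (hW j z).2 (hβ c j)
  have hgood : ∀ z, (∀ i, z i ≠ 0) → δ * Real.exp (-1) / 2 * radial d v z ≤ ‖G z‖ ∧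
      ‖G z‖ ≤ geomConst * radial d v z := by
    intro z hz
    have hz0 : 0 < ‖z‖₊ := nnnorm_pos.2 (ne_zero_of_forall hd hz)
    have h1 := hmain V ‖z‖ (fun j => W j z) (by exact_mod_cast hz0) fun j => hW j z
    rw [show Real.exp (logTransform v (Real.log ‖z‖)) = radial d v z from
      exp_logTransform hv hz0] at h1
    exact ⟨h1.2, h1.1⟩
  have hall : ∀ z, δ * Real.exp (-1) / 2 * radial d v z ≤ ‖G z‖ ∧
      ‖G z‖ ≤ geomConst * radial d v z := by
    have hGc := hG.continuous
    have hvc := continuous_radial (d := d) hv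
    exact fun z => ⟨le_of_forall_ne_zero (by fun_prop) (by fun_prop) (fun z hz => (hgood z hz).1) z,
      le_of_forall_ne_zero (by fun_prop) (by fun_prop) (fun z hz => (hgood z hz).2) z⟩
  have hGv : Equivalent (radial d v) (fun z => ‖G z‖) :=
    ⟨_, _, by positivity, hK, hall⟩
  let e : (Fin N → V) ≃L[ℂ] Cd (Module.finrank ℂ (Fin N → V)) :=
    ContinuousLinearEquiv.ofFinrankEq (by simp)
  have hn : 1 ≤ Module.finrank ℂ (Fin N → V) := by
    have h0 : G 0 ≠ 0 := norm_pos_iff.1 <| lt_of_lt_of_le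
      (mul_pos (by positivity) (hv.pos _)) (hall 0).1
    have : Nontrivial (Fin N → V) := ⟨⟨G 0, 0, h0⟩⟩
    exact Module.finrank_pos
  have : Nontrivial (Fin N → V) := Module.nontrivial_of_finrank_pos hn
  let A : (Fin N → V) →L[ℂ] Cd (Module.finrank ℂ (Fin N → V)) := e
  let B : Cd (Module.finrank ℂ (Fin N → V)) →L[ℂ] (Fin N → V) := e.symm
  have hB : 0 < ‖B‖ := e.norm_symm_pos
  have heq : Equivalent (fun z => ‖G z‖) (fun z => ‖e (G z)‖) := by
    refine ⟨‖B‖⁻¹, ‖A‖, inv_pos.2 hB, e.norm_pos, fun z => ⟨?_, A.le_opNorm (G z)⟩⟩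
    rw [inv_mul_le_iff₀ hB]
    simpa [B] using B.le_opNorm (e (G z))
  exact ⟨_, hn, fun z => e (G z), e.differentiable.comp hG,
    ((hwv.comp _).trans (hGv.trans heq)).symm⟩

/-! ### The largest tropical minorant of a weight -/

/-- `w` is comparable, at each `t ≥ 0`, to the modulus of an entire
function of one variable which may depend on the point and is dominated by `w` on `ℂ`. -/
def IsEssentialOnLine (w : ℝ≥0 → ℝ) : Prop :=
  ∃ c : ℝ, 0 < c ∧ ∀ t : ℝ≥0, ∃ g : ℂ → ℂ, Differentiable ℂ g ∧ (∀ l, ‖g l‖ ≤ w ‖l‖₊) ∧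
    c * w t ≤ ‖g (t : ℝ)‖

/-- The largest `B ≥ 0` such that `B * t ^ j ≤ w t` for all `t`. -/
noncomputable def minorantCoeff (w : ℝ≥0 → ℝ) (j : ℕ) : ℝ :=
  ⨅ t : {t : ℝ≥0 // 0 < t}, w t / (t : ℝ) ^ j

/-- The supremum of all multiples of monomials below `w`. -/
noncomputable def tropicalMinorant (w : ℝ≥0 → ℝ) (t : ℝ≥0) : ℝ :=
  ⨆ j : ℕ, minorantCoeff w j * (t : ℝ) ^ j

lemma le_of_forall_pos_le {f g : ℝ≥0 → ℝ} (hf : Continuous f) (hg : Continuous g)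
    (h : ∀ t, 0 < t → f t ≤ g t) (t : ℝ≥0) : f t ≤ g t := by
  refine (isClosed_le hf hg).closure_subset_iff.2 h (?_ : t ∈ closure (Set.Ioi 0))
  rw [closure_Ioi]
  exact zero_le (a := t)

section Minorant

variable {w : ℝ≥0 → ℝ}

lemma minorantCoeff_nonneg (hw : IsWeight w) (j : ℕ) : 0 ≤ minorantCoeff w j :=
  Real.iInf_nonneg fun t => div_nonneg (hw.pos t).le (by positivity)

lemma le_minorantCoeff_zero (hw : IsWeight w) : w 0 ≤ minorantCoeff w 0 := by
  have : Nonempty {t : ℝ≥0 // 0 < t} := ⟨⟨1, one_pos⟩⟩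
  exact le_ciInf fun t => by simpa using hw.mono (zero_le (a := (t : ℝ≥0)))

lemma minorantCoeff_mul_pow_le (hw : IsWeight w) (j : ℕ) (t : ℝ≥0) :
    minorantCoeff w j * (t : ℝ) ^ j ≤ w t := by
  have hpos : ∀ t : ℝ≥0, 0 < t → minorantCoeff w j * (t : ℝ) ^ j ≤ w t := fun t ht => by
    rw [← le_div_iff₀ (pow_pos (NNReal.coe_pos.2 ht) j)]
    refine ciInf_le ⟨0, ?_⟩ (⟨t, ht⟩ : {t : ℝ≥0 // 0 < t})
    rintro _ ⟨s, rfl⟩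
    exact div_nonneg (hw.pos s).le (by positivity)
  exact le_of_forall_pos_le (by fun_prop) hw.cont hpos t

lemma bddAbove_minorant (hw : IsWeight w) (t : ℝ≥0) :
    BddAbove (Set.range fun j : ℕ => minorantCoeff w j * (t : ℝ) ^ j) :=
  ⟨w t, by rintro _ ⟨j, rfl⟩; exact minorantCoeff_mul_pow_le hw j t⟩

lemma le_tropicalMinorant (hw : IsWeight w) (j : ℕ) (t : ℝ≥0) :
    minorantCoeff w j * (t : ℝ) ^ j ≤ tropicalMinorant w t :=
  le_ciSup (bddAbove_minorant hw t) j

lemma tropicalMinorant_le (hw : IsWeight w) (t : ℝ≥0) : tropicalMinorant w t ≤ w t :=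
  ciSup_le fun j => minorantCoeff_mul_pow_le hw j t

lemma tropicalMinorant_ge (hw : IsWeight w) (t : ℝ≥0) : w 0 ≤ tropicalMinorant w t := by
  simpa using (le_minorantCoeff_zero hw).trans
    (by simpa using le_tropicalMinorant hw 0 t)

lemma tropicalMinorant_pos (hw : IsWeight w) (t : ℝ≥0) : 0 < tropicalMinorant w t :=
  (hw.pos 0).trans_le (tropicalMinorant_ge hw t)

lemma tropicalMinorant_mono (hw : IsWeight w) : Monotone (tropicalMinorant w) := fun s t hst =>
  ciSup_mono (bddAbove_minorant hw t) fun j => by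
    have := minorantCoeff_nonneg hw j
    gcongr

lemma mul_pow_sub_pow_le {s t R : ℝ} (hs : 0 ≤ s) (hst : s ≤ t) (htR : t ≤ R) (j : ℕ) :
    R * (t ^ j - s ^ j) ≤ (2 * R) ^ j * (t - s) := by
  have ht := hs.trans hst
  have hR := ht.trans htR
  have hd := sub_nonneg.2 hst
  induction j with
  | zero => simpa using hd
  | succ j ih =>
    have h1 : t * (R * (t ^ j - s ^ j)) ≤ R * ((2 * R) ^ j * (t - s)) :=
      (mul_le_mul_of_nonneg_left ih ht).trans (mul_le_mul_of_nonneg_right htR (by positivity))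
    have h2 : R * (s ^ j * (t - s)) ≤ R * ((2 * R) ^ j * (t - s)) := by
      gcongr
      linarith
    calc R * (t ^ (j + 1) - s ^ (j + 1))
        = t * (R * (t ^ j - s ^ j)) + R * (s ^ j * (t - s)) := by ring
      _ ≤ R * ((2 * R) ^ j * (t - s)) + R * ((2 * R) ^ j * (t - s)) := add_le_add h1 h2
      _ = _ := by ring

/-- The minorant is locally Lipschitz: on `[0, R]`, the Lipschitz constants of the monomials
`B j * t ^ j` are bounded by their values at `2 R`, divided by `R`. -/
lemma continuous_tropicalMinorant (hw : IsWeight w) : Continuous (tropicalMinorant w) := by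
  refine continuous_iff_continuousAt.2 fun t₀ => ?_
  set R : ℝ≥0 := t₀ + 1
  have hR : (0 : ℝ) < R := by positivity
  have hwR : 0 ≤ w (2 * R) / R := div_nonneg (hw.pos _).le hR.le
  have hlip : LipschitzOnWith ⟨w (2 * R) / R, hwR⟩ (tropicalMinorant w) (Set.Iic R) := by
    refine LipschitzOnWith.of_le_add_mul _ fun t ht s hs => ?_
    have hnn : 0 ≤ w (2 * R) / R * dist t s := by positivity
    rcases le_total t s with hts | hst
    · exact (tropicalMinorant_mono hw hts).trans (le_add_of_nonneg_right hnn)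
    · refine ciSup_le fun j => ?_
      have h1 := mul_pow_sub_pow_le s.2 (NNReal.coe_le_coe.2 hst) (NNReal.coe_le_coe.2 ht) j
      have h2 := minorantCoeff_mul_pow_le hw j (2 * R)
      have h3 := le_tropicalMinorant hw j s
      have h4 : dist t s = (t : ℝ) - s := by
        rw [NNReal.dist_eq, abs_of_nonneg (sub_nonneg.2 (NNReal.coe_le_coe.2 hst))]
      have h5 : minorantCoeff w j * ((t : ℝ) ^ j - (s : ℝ) ^ j) ≤
          w (2 * R) / R * ((t : ℝ) - s) := by
        rw [div_mul_eq_mul_div, le_div_iff₀ hR]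
        push_cast at h2
        calc _ = minorantCoeff w j * (R * ((t : ℝ) ^ j - (s : ℝ) ^ j)) := by ring
          _ ≤ minorantCoeff w j * ((2 * R) ^ j * ((t : ℝ) - s)) :=
            mul_le_mul_of_nonneg_left h1 (minorantCoeff_nonneg hw j)
          _ = minorantCoeff w j * (2 * R) ^ j * ((t : ℝ) - s) := by ring
          _ ≤ _ := mul_le_mul_of_nonneg_right h2 (sub_nonneg.2 (NNReal.coe_le_coe.2 hst))
      rw [h4]
      change _ ≤ tropicalMinorant w s + w (2 * R) / R * ((t : ℝ) - s)
      linarith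
  exact hlip.continuousOn.continuousAt (Iic_mem_nhds (lt_add_one t₀))

lemma isLogTropical_tropicalMinorant (hw : IsWeight w) : IsLogTropical (tropicalMinorant w) := by
  refine ⟨{j | 0 < minorantCoeff w j}, fun j => Real.log (minorantCoeff w j), fun x => ?_⟩
  set t : ℝ≥0 := (Real.exp x).toNNReal
  have ht : (t : ℝ) = Real.exp x := Real.coe_toNNReal _ (Real.exp_pos x).le
  have hlog : ∀ j : ℕ, 0 < minorantCoeff w j →
      Real.exp (Real.log (minorantCoeff w j) + j * x) = minorantCoeff w j * (t : ℝ) ^ j :=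
    fun j hj => by rw [Real.exp_add, Real.exp_log hj, Real.exp_nat_mul, ht]
  have hpos := tropicalMinorant_pos hw t
  refine ⟨?_, fun y hy => ?_⟩
  · rintro _ ⟨j, hj, rfl⟩
    refine (Real.le_log_iff_exp_le hpos).2 ?_
    dsimp only
    rw [hlog j hj]
    exact le_tropicalMinorant hw j t
  · refine (Real.log_le_iff_le_exp hpos).2 (ciSup_le fun j => ?_)
    rcases (minorantCoeff_nonneg hw j).eq_or_lt with h0 | hj
    · rw [← h0, zero_mul]
      positivity
    · rw [← hlog j hj]
      exact Real.exp_le_exp.2 (hy ⟨j, hj, rfl⟩)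

end Minorant

/-! ### Essential weights are equivalent to their tropical minorants -/

/-- The maximum principle for `g z / z ^ n` on an annulus, a three-circles theorem with integer
exponents. -/
lemma norm_le_mul_pow_of_annulus {g : ℂ → ℂ} (hg : Differentiable ℂ g) {a b M : ℝ} (ha : 0 < a)
    (n : ℕ) (hga : ∀ z, ‖z‖ = a → ‖g z‖ ≤ M * a ^ n) (hgb : ∀ z, ‖z‖ = b → ‖g z‖ ≤ M * b ^ n)
    {z : ℂ} (hza : a ≤ ‖z‖) (hzb : ‖z‖ ≤ b) : ‖g z‖ ≤ M * ‖z‖ ^ n := by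
  rcases hza.eq_or_lt with h | hza
  · rw [← h]; exact hga z h.symm
  rcases hzb.eq_or_lt with h | hzb
  · rw [h]; exact hgb z h
  set U : Set ℂ := {z | a < ‖z‖ ∧ ‖z‖ < b}
  have hUo : IsOpen U :=
    (isOpen_lt continuous_const continuous_norm).inter (isOpen_lt continuous_norm continuous_const)
  have hUb : Bornology.IsBounded U :=
    Metric.isBounded_ball.subset fun z (hz : z ∈ U) => (by simpa using hz.2 : z ∈ Metric.ball 0 b)
  have hUc : closure U ⊆ {z | a ≤ ‖z‖ ∧ ‖z‖ ≤ b} :=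
    closure_minimal (fun z hz => ⟨hz.1.le, hz.2.le⟩)
      ((isClosed_le continuous_const continuous_norm).inter
        (isClosed_le continuous_norm continuous_const))
  have hne : ∀ z ∈ closure U, z ^ n ≠ 0 := fun z hz =>
    pow_ne_zero _ (norm_pos_iff.1 (ha.trans_le (hUc hz).1))
  have hF : DiffContOnCl ℂ (fun z => g z / z ^ n) U :=
    ⟨hg.differentiableOn.div (differentiable_pow n).differentiableOn
      fun z hz => hne z (subset_closure hz),
      hg.continuous.continuousOn.div (continuous_pow n).continuousOn hne⟩
  have hb := ha.trans (hza.trans hzb)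
  have key := Complex.norm_le_of_forall_mem_frontier_norm_le hUb hF (C := M) (fun ζ hζ => by
    rw [hUo.frontier_eq] at hζ
    have h1 := hUc hζ.1
    rw [norm_div, norm_pow, div_le_iff₀ (pow_pos (ha.trans_le h1.1) n)]
    rcases h1.1.eq_or_lt with h | h
    · rw [← h]; exact hga ζ h.symm
    · have h' : ‖ζ‖ = b := le_antisymm h1.2 (not_lt.1 fun h'' => hζ.2 ⟨h, h''⟩)
      rw [h']; exact hgb ζ h') (subset_closure (⟨hza, hzb⟩ : z ∈ U))
  rwa [norm_div, norm_pow, div_le_iff₀ (pow_pos (ha.trans hza) n)] at key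

/-- Power series expansion with Cauchy's estimates on every circle. -/
lemma exists_hasSum_of_entire {g : ℂ → ℂ} (hg : Differentiable ℂ g) {w : ℝ≥0 → ℝ}
    (hgw : ∀ l, ‖g l‖ ≤ w ‖l‖₊) : ∃ α : ℕ → ℂ, (∀ z, HasSum (fun j => α j * z ^ j) (g z)) ∧
      ∀ (j : ℕ) (R : ℝ≥0), 0 < R → ‖α j‖ * (R : ℝ) ^ j ≤ w R := by
  refine ⟨fun j => (j.factorial : ℂ)⁻¹ * iteratedDeriv j g 0, fun z => ?_, fun j R hR => ?_⟩
  · have := Complex.hasSum_taylorSeries_of_entire hg 0 z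
    simp only [sub_zero, smul_eq_mul] at this
    exact this.congr_fun fun j => by ring
  · have hR' : (0 : ℝ) < R := NNReal.coe_pos.2 hR
    have := Complex.norm_iteratedDeriv_le_of_forall_mem_sphere_norm_le (c := 0) (C := w R) j hR'
      hg.diffContOnCl fun z hz => by
        have hz' : ‖z‖₊ = R := NNReal.eq (by simpa using hz)
        rw [← hz']; exact hgw z
    have hj : (0 : ℝ) < j.factorial := by exact_mod_cast j.factorial_pos
    rw [norm_mul, norm_inv, Complex.norm_natCast, ← le_div_iff₀ (pow_pos hR' j),
      inv_mul_le_iff₀ hj]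
    rwa [mul_div_assoc] at this

lemma exists_exponent {w : ℝ≥0 → ℝ} (hw : IsWeight w) {c : ℝ} (hc : 0 < c) (hc1 : c ≤ 1)
    {t₀ : ℝ≥0} (ht₀ : 0 < t₀) : ∃ k : ℕ,
      (∀ t, t₀ ≤ t → c * w t₀ * (t : ℝ) ^ k ≤ w t * (t₀ : ℝ) ^ k) ∧
      ∃ t, t₀ ≤ t ∧ w t * (t₀ : ℝ) ^ (k + 1) < c * w t₀ * (t : ℝ) ^ (k + 1) := by
  classical
  have hw0 := hw.pos t₀
  have ht0 : (0 : ℝ) < t₀ := NNReal.coe_pos.2 ht₀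
  have hex : ∃ k : ℕ, ∃ t, t₀ ≤ t ∧ w t * (t₀ : ℝ) ^ k < c * w t₀ * (t : ℝ) ^ k := by
    obtain ⟨k, hk⟩ := pow_unbounded_of_one_lt (w (2 * t₀) / (c * w t₀)) one_lt_two
    refine ⟨k, 2 * t₀, le_mul_of_one_le_left (zero_le (a := t₀)) one_le_two, ?_⟩
    rw [div_lt_iff₀ (by positivity)] at hk
    push_cast
    rw [mul_pow, ← mul_assoc]
    gcongr
    linarith
  obtain ⟨k, hk⟩ : ∃ k, Nat.find hex = k + 1 := by
    refine Nat.exists_eq_succ_of_ne_zero fun h0 => ?_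
    obtain ⟨t, ht, hlt⟩ := (Nat.find_eq_zero hex).1 h0
    have := hw.mono ht
    simp only [pow_zero, mul_one] at hlt
    nlinarith
  refine ⟨k, fun t ht => not_lt.1 fun hlt => ?_, hk ▸ Nat.find_spec hex⟩
  exact Nat.find_min hex (m := k) (by omega) ⟨t, ht, hlt⟩

/-- The constant `∑ 2 ^ (-|n|)` over the integers. -/
noncomputable def dyadicConst : ℝ := ∑' n : ℤ, (1 / 2 : ℝ) ^ n.natAbs

lemma summable_dyadic : Summable fun n : ℤ => (1 / 2 : ℝ) ^ n.natAbs := by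
  apply Summable.of_nat_of_neg <;>
  simpa using summable_geometric_of_lt_one (r := (1 / 2 : ℝ)) (by norm_num) (by norm_num)

lemma one_le_dyadicConst : 1 ≤ dyadicConst := by
  simpa [dyadicConst] using summable_dyadic.le_tsum 0 fun _ _ => by positivity

/-- If an entire function dominated by `w` has modulus comparable to `w` at `t₀`, then so has the
tropical minorant. Let `k` be the integer part of the slope of `log w` at `log t₀`, determined up
to constants by `exists_exponent` and the maximum principle. If both monomials of degrees `k` and
`k + 1` were small at `t₀`, this would be seen at radii `a < t₀ / 2` and `b > 2 t₀`, and Cauchy's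
estimates on these two circles would make the power series at `t₀` too small. -/
lemma mul_le_tropicalMinorant {w : ℝ≥0 → ℝ} (hw : IsWeight w) {c : ℝ} (hc : 0 < c)
    {g : ℂ → ℂ} (hg : Differentiable ℂ g) (hgw : ∀ l, ‖g l‖ ≤ w ‖l‖₊) {t₀ : ℝ≥0} (ht₀ : 0 < t₀)
    (hgt : c * w t₀ ≤ ‖g (t₀ : ℝ)‖) :
    c / (4 * dyadicConst) * w t₀ ≤ tropicalMinorant w t₀ := by
  have hw0 := hw.pos t₀
  have ht0 : (0 : ℝ) < t₀ := NNReal.coe_pos.2 ht₀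
  have hS := one_le_dyadicConst
  have hnn : ‖((t₀ : ℝ) : ℂ)‖₊ = t₀ := by
    ext; simp
  have hc1 : c ≤ 1 := by
    have := hgt.trans (hgw _)
    rw [hnn] at this
    nlinarith
  set c' := c / (4 * dyadicConst)
  have hc' : 0 < c' := by positivity
  have hc'S : c' * (4 * dyadicConst) = c := div_mul_cancel₀ _ (by positivity)
  have hc'c : c' ≤ c / 4 := by nlinarith
  obtain ⟨k, hk, t₁, ht₁, hlt₁⟩ := exists_exponent hw hc hc1 ht₀
  have hleft : ∀ t, 0 < t → t ≤ t₀ → c * w t₀ * (t : ℝ) ^ (k + 1) ≤ w t * (t₀ : ℝ) ^ (k + 1) := by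
    intro t ht htt
    by_contra! hcon
    have ht' : (0 : ℝ) < t := NNReal.coe_pos.2 ht
    have ht1' : (0 : ℝ) < t₁ := NNReal.coe_pos.2 (ht₀.trans_le ht₁)
    set M := max (w t / (t : ℝ) ^ (k + 1)) (w t₁ / (t₁ : ℝ) ^ (k + 1))
    have hM : M * (t₀ : ℝ) ^ (k + 1) < c * w t₀ := by
      rw [← lt_div_iff₀ (by positivity)]
      refine max_lt ?_ ?_
      · rw [div_lt_div_iff₀ (by positivity) (by positivity)]; exact hcon
      · rw [div_lt_div_iff₀ (by positivity) (by positivity)]; exact hlt₁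
    have := norm_le_mul_pow_of_annulus hg (M := M) ht' (k + 1) (b := t₁) (z := ((t₀ : ℝ) : ℂ))
      (fun z hz => by
        have hz' : ‖z‖₊ = t := NNReal.eq hz
        refine (hgw z).trans ?_
        rw [hz', ← div_le_iff₀ (by positivity)]
        exact le_max_left _ _)
      (fun z hz => by
        have hz' : ‖z‖₊ = t₁ := NNReal.eq hz
        refine (hgw z).trans ?_
        rw [hz', ← div_le_iff₀ (by positivity)]
        exact le_max_right _ _) (by simpa using htt) (by simpa using ht₁)
    have hn : ‖((t₀ : ℝ) : ℂ)‖ = t₀ := by simp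
    rw [hn] at this
    linarith
  by_contra! hcon
  have : Nonempty {t : ℝ≥0 // 0 < t} := ⟨⟨1, one_pos⟩⟩
  have hexists : ∀ j, ∃ t : ℝ≥0, 0 < t ∧ w t * (t₀ : ℝ) ^ j < c' * w t₀ * (t : ℝ) ^ j := by
    intro j
    have h1 := (le_tropicalMinorant hw j t₀).trans_lt hcon
    rw [← lt_div_iff₀ (by positivity)] at h1
    obtain ⟨⟨t, ht⟩, hlt⟩ := exists_lt_of_ciInf_lt h1
    have ht' : (0 : ℝ) < t := NNReal.coe_pos.2 ht
    rw [div_lt_div_iff₀ (by positivity) (by positivity)] at hlt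
    exact ⟨t, ht, hlt⟩
  obtain ⟨a, ha, hwa⟩ := hexists k
  obtain ⟨b, hb, hwb⟩ := hexists (k + 1)
  have ha' : (0 : ℝ) < a := NNReal.coe_pos.2 ha
  have hb' : (0 : ℝ) < b := NNReal.coe_pos.2 hb
  have hlt_c : ∀ p : ℝ, 0 < p → c' * w t₀ * p < c * w t₀ * p := fun p hp => by
    have : c' < c := by linarith
    gcongr
  have hat : (a : ℝ) / t₀ ≤ 1 / 2 := by
    have hat0 : a < t₀ := by
      by_contra! h
      linarith [hk a h, hlt_c ((a : ℝ) ^ k) (by positivity)]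
    have h1 := hleft a ha hat0.le
    rw [pow_succ, pow_succ] at h1
    have h2 : c * w t₀ * (a : ℝ) ^ k * a < c' * w t₀ * (a : ℝ) ^ k * t₀ := by nlinarith
    have h3 : c * a < c' * t₀ := by
      have h4 : 0 < w t₀ * (a : ℝ) ^ k := by positivity
      refine lt_of_mul_lt_mul_left ?_ h4.le
      linarith
    rw [div_le_iff₀ ht0]
    nlinarith
  have hbt : (t₀ : ℝ) / b ≤ 1 / 2 := by
    have hbt0 : t₀ < b := by
      by_contra! h
      linarith [hleft b hb h, hlt_c ((b : ℝ) ^ (k + 1)) (by positivity)]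
    have h1 := hk b hbt0.le
    rw [pow_succ, pow_succ] at hwb
    have h2 : c * w t₀ * (b : ℝ) ^ k * t₀ < c' * w t₀ * (b : ℝ) ^ k * b := by nlinarith
    have h3 : c * t₀ < c' * b := by
      have h4 : 0 < w t₀ * (b : ℝ) ^ k := by positivity
      refine lt_of_mul_lt_mul_left ?_ h4.le
      linarith
    rw [div_le_iff₀ hb']
    nlinarith
  obtain ⟨α, hα, hαw⟩ := exists_hasSum_of_entire hg hgw
  have hterm : ∀ j : ℕ, ‖α j * ((t₀ : ℝ) : ℂ) ^ j‖ ≤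
      2 * (c' * w t₀) * (1 / 2 : ℝ) ^ ((j : ℤ) - k).natAbs := by
    intro j
    have hn : ‖((t₀ : ℝ) : ℂ)‖ = t₀ := by simp
    rw [norm_mul, norm_pow, hn]
    rcases le_or_gt j k with hjk | hjk
    · obtain ⟨i, rfl⟩ := Nat.exists_eq_add_of_le hjk
      have e : ((j : ℤ) - (j + i : ℕ)).natAbs = i := by omega
      rw [e]
      have h1 : ‖α j‖ * (t₀ : ℝ) ^ j ≤ c' * w t₀ * ((a : ℝ) / t₀) ^ i := by
        have h2 := hαw j a ha
        rw [div_pow, ← mul_div_assoc, le_div_iff₀ (by positivity)]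
        refine le_of_mul_le_mul_right ?_ (pow_pos ha' j)
        calc ‖α j‖ * (t₀ : ℝ) ^ j * (t₀ : ℝ) ^ i * (a : ℝ) ^ j
            = ‖α j‖ * (a : ℝ) ^ j * (t₀ : ℝ) ^ (j + i) := by ring
          _ ≤ w a * (t₀ : ℝ) ^ (j + i) := by gcongr
          _ ≤ _ := hwa.le
          _ = _ := by ring
      refine h1.trans ?_
      have : ((a : ℝ) / t₀) ^ i ≤ (1 / 2) ^ i := by gcongr
      nlinarith [mul_pos hc' hw0, pow_pos (show (0 : ℝ) < 1 / 2 by norm_num) i]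
    · obtain ⟨i, rfl⟩ := Nat.exists_eq_add_of_lt hjk
      have e : (((k + i + 1 : ℕ) : ℤ) - k).natAbs = i + 1 := by omega
      rw [e]
      have h1 : ‖α (k + i + 1)‖ * (t₀ : ℝ) ^ (k + i + 1) ≤ c' * w t₀ * ((t₀ : ℝ) / b) ^ i := by
        have h2 := hαw (k + i + 1) b hb
        rw [div_pow, ← mul_div_assoc, le_div_iff₀ (by positivity)]
        refine le_of_mul_le_mul_right ?_ (pow_pos hb' (k + 1))
        calc ‖α (k + i + 1)‖ * (t₀ : ℝ) ^ (k + i + 1) * (b : ℝ) ^ i * (b : ℝ) ^ (k + 1)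
            = ‖α (k + i + 1)‖ * (b : ℝ) ^ (k + i + 1) * (t₀ : ℝ) ^ (k + i + 1) := by ring
          _ ≤ w b * (t₀ : ℝ) ^ (k + i + 1) := by gcongr
          _ = w b * (t₀ : ℝ) ^ (k + 1) * (t₀ : ℝ) ^ i := by ring
          _ ≤ c' * w t₀ * (b : ℝ) ^ (k + 1) * (t₀ : ℝ) ^ i := by gcongr
          _ = _ := by ring
      refine h1.trans ?_
      have : ((t₀ : ℝ) / b) ^ i ≤ (1 / 2) ^ i := by gcongr
      rw [pow_succ]
      nlinarith [mul_pos hc' hw0, pow_pos (show (0 : ℝ) < 1 / 2 by norm_num) i]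
  have hinj : Function.Injective fun j : ℕ => (j : ℤ) - k := fun i j hij => by
    simpa using hij
  have hsum : Summable fun j : ℕ => (1 / 2 : ℝ) ^ ((j : ℤ) - k).natAbs :=
    summable_dyadic.comp_injective hinj
  have hfin : ‖g (t₀ : ℝ)‖ ≤ 2 * (c' * w t₀) * dyadicConst := by
    rw [← (hα _).tsum_eq]
    refine (tsum_of_norm_bounded (hsum.mul_left _).hasSum hterm).trans ?_
    rw [tsum_mul_left]
    have := tsum_comp_le_tsum_of_inj summable_dyadic (fun _ => by positivity) hinj
    gcongr
    exact this
  have : 2 * (c' * w t₀) * dyadicConst = c * w t₀ / 2 := by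
    rw [← hc'S]; ring
  nlinarith

theorem IsEssentialOnLine.isTropicallyEquivalent {w : ℝ≥0 → ℝ} (hw : IsWeight w)
    (h : IsEssentialOnLine w) : IsTropicallyEquivalent w := by
  obtain ⟨c, hc, h⟩ := h
  have hS := one_le_dyadicConst
  have hle : ∀ t, min 1 (c / (4 * dyadicConst)) * w t ≤ tropicalMinorant w t := fun t => by
    rcases (zero_le (a := t)).eq_or_lt with rfl | ht
    · exact (mul_le_of_le_one_left (hw.pos _).le (min_le_left _ _)).trans
        (tropicalMinorant_ge hw 0)
    · obtain ⟨g, hg, hgw, hgt⟩ := h t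
      exact (mul_le_mul_of_nonneg_right (min_le_right _ _) (hw.pos _).le).trans
        (mul_le_tropicalMinorant hw hc hg hgw ht hgt)
  have hmin : 0 < min 1 (c / (4 * dyadicConst)) := lt_min one_pos (by positivity)
  refine ⟨tropicalMinorant w, ⟨tropicalMinorant_pos hw, tropicalMinorant_mono hw,
    continuous_tropicalMinorant hw, ?_⟩, isLogTropical_tropicalMinorant hw,
    _, 1, hmin, one_pos, fun t => ⟨hle t, by simpa using tropicalMinorant_le hw t⟩⟩
  rintro ⟨A, hA⟩
  refine hw.unbounded ⟨A / min 1 (c / (4 * dyadicConst)), ?_⟩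
  rintro _ ⟨t, rfl⟩
  rw [le_div_iff₀ hmin, mul_comm]
  exact (hle t).trans (hA ⟨t, rfl⟩)

/-! ### Restriction to complex lines -/

/-- Restricting to a complex line: it suffices to find, for each radius, an entire function on
`ℂ^d` dominated by `w` whose modulus is comparable to `w` at one point of this radius. -/
lemma isEssentialOnLine_of_exists {d : ℕ} (hd : 1 ≤ d) {w : ℝ≥0 → ℝ} {c : ℝ} (hc : 0 < c)
    (h : ∀ t : ℝ≥0, ∃ (f : Cd d → ℂ) (z : Cd d), Differentiable ℂ f ∧
      (∀ ζ, ‖f ζ‖ ≤ radial d w ζ) ∧ ‖z‖₊ = t ∧ c * w t ≤ ‖f z‖) : IsEssentialOnLine w := by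
  refine ⟨c, hc, fun t => ?_⟩
  obtain ⟨f, z, hf, hfw, hz, hfz⟩ := h t
  obtain ⟨ξ, hξ, hzξ⟩ : ∃ ξ : Cd d, ‖ξ‖₊ = 1 ∧ ((t : ℝ) : ℂ) • ξ = z := by
    rcases eq_or_ne z 0 with rfl | hz0
    · refine ⟨EuclideanSpace.single ⟨0, hd⟩ 1, by ext; simp, ?_⟩
      rw [← hz]
      simp
    · have hn : ‖z‖ ≠ 0 := norm_ne_zero_iff.2 hz0
      refine ⟨((‖z‖⁻¹ : ℝ) : ℂ) • z, ?_, ?_⟩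
      · ext
        simp [norm_smul, hn]
      · rw [← hz, smul_smul, ← Complex.ofReal_mul, coe_nnnorm, mul_inv_cancel₀ hn]
        simp
  refine ⟨fun l => f (l • ξ), hf.comp (differentiable_id.smul_const ξ), fun l => ?_, ?_⟩
  · refine (hfw _).trans_eq ?_
    rw [radial, nnnorm_smul, hξ, mul_one]
  · rwa [← hzξ] at hfz

lemma exists_nnnorm_eq {d : ℕ} (hd : 1 ≤ d) (t : ℝ≥0) : ∃ z : Cd d, ‖z‖₊ = t :=
  ⟨EuclideanSpace.single ⟨0, hd⟩ ((t : ℝ) : ℂ), by ext; simp⟩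

lemma IsEssential.isEssentialOnLine {d : ℕ} (hd : 1 ≤ d) {w : ℝ≥0 → ℝ} (hw : IsWeight w)
    (h : IsEssential d w) : IsEssentialOnLine w := by
  obtain ⟨C₁, C₂, h₁, h₂, h⟩ := h
  refine isEssentialOnLine_of_exists hd (c := C₂⁻¹ / 2) (by positivity) fun t => ?_
  obtain ⟨z, hz⟩ := exists_nnnorm_eq hd t
  have hwz : radial d w z = w t := by rw [radial, hz]
  have hwt := hw.pos t
  have hlt : C₂⁻¹ / 2 * w t < associatedWeight d w z := by
    have h3 : C₂⁻¹ * w t ≤ associatedWeight d w z := by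
      rw [inv_mul_le_iff₀ h₂, ← hwz]
      exact (h z).2
    have h4 : 0 < C₂⁻¹ * w t := by positivity
    linarith
  obtain ⟨_, ⟨f, hf, hfw, rfl⟩, hfz⟩ := exists_lt_of_lt_csSup
    (by exact ⟨_, 0, differentiable_const 0,
      fun ζ => by simpa [radial] using (hw.pos _).le, rfl⟩) hlt
  exact ⟨f, z, hf, hfw, hz, hfz.le⟩

lemma isCompact_image_sphere {d : ℕ} {f : Cd d → ℂ} (hf : Continuous f) (t : ℝ≥0) :
    IsCompact ((fun z => ‖f z‖) '' Metric.sphere (0 : Cd d) (t : ℝ)) :=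
  (isCompact_sphere _ _).image hf.norm

lemma norm_le_maxModulus {d : ℕ} {f : Cd d → ℂ} (hf : Continuous f) (z : Cd d) :
    ‖f z‖ ≤ maxModulus f ‖z‖₊ :=
  le_csSup (isCompact_image_sphere hf _).bddAbove ⟨z, by simp, rfl⟩

lemma exists_norm_eq_maxModulus {d : ℕ} (hd : 1 ≤ d) {f : Cd d → ℂ} (hf : Continuous f)
    (t : ℝ≥0) : ∃ z : Cd d, ‖z‖₊ = t ∧ ‖f z‖ = maxModulus f t := by
  obtain ⟨z₀, hz₀⟩ := exists_nnnorm_eq hd t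
  obtain ⟨z, hz, hfz⟩ := (isCompact_image_sphere hf t).sSup_mem
    ⟨_, z₀, by simp [← hz₀], rfl⟩
  exact ⟨z, NNReal.eq (by simpa using hz), hfz⟩

lemma IsMaxApproximable.isEssentialOnLine {d : ℕ} (hd : 1 ≤ d) {w : ℝ≥0 → ℝ}
    (h : IsMaxApproximable d w) : IsEssentialOnLine w := by
  obtain ⟨f, hf, C₁, C₂, h₁, h₂, h⟩ := h
  refine isEssentialOnLine_of_exists hd (c := C₁ * C₂⁻¹) (by positivity) fun t => ?_
  obtain ⟨z, hz, hfz⟩ := exists_norm_eq_maxModulus hd hf.continuous t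
  refine ⟨fun ζ => (C₁ : ℂ) * f ζ, z, hf.const_mul _, fun ζ => ?_, hz, ?_⟩
  · rw [norm_mul, Complex.norm_real, Real.norm_of_nonneg h₁.le]
    exact (mul_le_mul_of_nonneg_left (norm_le_maxModulus hf.continuous ζ) h₁.le).trans (h _).1
  · rw [norm_mul, Complex.norm_real, Real.norm_of_nonneg h₁.le, hfz, mul_assoc]
    refine mul_le_mul_of_nonneg_left ?_ h₁.le
    rw [inv_mul_le_iff₀ h₂]
    exact (h t).2

lemma IsApproximable.isEssentialOnLine {d : ℕ} (hd : 1 ≤ d) {w : ℝ≥0 → ℝ}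
    (h : IsApproximable d w) : IsEssentialOnLine w := by
  obtain ⟨n, hn, f, hf, C₁, C₂, h₁, h₂, h⟩ := h
  have hn' : (0 : ℝ) < √n := Real.sqrt_pos.2 (by exact_mod_cast hn)
  refine isEssentialOnLine_of_exists hd (c := C₁ * (√n)⁻¹ * C₂⁻¹) (by positivity) fun t => ?_
  obtain ⟨z, hz⟩ := exists_nnnorm_eq hd t
  have : Nonempty (Fin n) := ⟨⟨0, hn⟩⟩
  -- The largest coordinate at `z`; it depends on `t`, which the definition allows.
  obtain ⟨i, hi⟩ := Finite.exists_max fun i => ‖f z i‖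
  have hfi : ‖f z‖ ≤ √n * ‖f z i‖ := by
    rw [EuclideanSpace.norm_eq]
    refine Real.sqrt_le_iff.2 ⟨by positivity, ?_⟩
    rw [mul_pow, Real.sq_sqrt (by positivity)]
    calc ∑ j, ‖f z j‖ ^ 2 ≤ ∑ _j : Fin n, ‖f z i‖ ^ 2 :=
          Finset.sum_le_sum fun j _ => by have := hi j; gcongr
      _ = _ := by simp
  refine ⟨fun ζ => (C₁ : ℂ) * f ζ i, z, (differentiable_euclidean.1 hf i).const_mul _,
    fun ζ => ?_, hz, ?_⟩
  · rw [norm_mul, Complex.norm_real, Real.norm_of_nonneg h₁.le]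
    exact (mul_le_mul_of_nonneg_left (PiLp.norm_apply_le _ i) h₁.le).trans (h ζ).1
  · rw [norm_mul, Complex.norm_real, Real.norm_of_nonneg h₁.le, mul_assoc, mul_assoc]
    refine mul_le_mul_of_nonneg_left ?_ h₁.le
    rw [inv_mul_le_iff₀ hn', inv_mul_le_iff₀ h₂]
    have h3 := (h z).2
    rw [radial, hz] at h3
    exact h3.trans (mul_le_mul_of_nonneg_left hfi h₂.le)

/-! ### Log-tropical weights are essential and approximable by maximum moduli -/

theorem isEssential_of_isTropicallyEquivalent {w : ℝ≥0 → ℝ} (hw : IsWeight w)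
    (h : IsTropicallyEquivalent w) (d : ℕ) : IsEssential d w := by
  obtain ⟨v, hv, ⟨E, b, hE⟩, C₁, C₂, h₁, h₂, hwv⟩ := h
  have hne : ∀ z, {r : ℝ | ∃ f : Cd d → ℂ, Differentiable ℂ f ∧ (∀ ζ, ‖f ζ‖ ≤ radial d w ζ) ∧
      r = ‖f z‖}.Nonempty := fun z =>
    ⟨_, 0, differentiable_const 0, fun ζ => by simpa [radial] using (hw.pos _).le, rfl⟩
  have hle : ∀ z, associatedWeight d w z ≤ radial d w z := fun z => csSup_le (hne z) <| by
    rintro _ ⟨f, -, hfw, rfl⟩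
    exact hfw z
  have hge : ∀ (f : Cd d → ℂ), Differentiable ℂ f → (∀ ζ, ‖f ζ‖ ≤ radial d w ζ) → ∀ z,
      ‖f z‖ ≤ associatedWeight d w z := fun f hf hfw z => le_csSup
    ⟨radial d w z, by rintro _ ⟨f, -, hfw, rfl⟩; exact hfw z⟩ ⟨f, hf, hfw, rfl⟩
  refine Equivalent.symm ⟨min 1 (C₁ / C₂), 1, lt_min one_pos (by positivity), one_pos, fun z =>
    ⟨?_, by simpa using hle z⟩⟩
  have hwz : 0 < radial d w z := hw.pos _
  rcases eq_or_ne z 0 with rfl | hz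
  · refine (mul_le_of_le_one_left hwz.le (min_le_left _ _)).trans ?_
    -- At the origin the constant function `w 0` is extremal.
    have := hge (fun _ => ((w 0 : ℝ) : ℂ)) (differentiable_const _) (fun ζ => by
      rw [Complex.norm_real, Real.norm_of_nonneg (hw.pos 0).le]
      exact hw.mono (zero_le (a := ‖ζ‖₊))) 0
    rw [Complex.norm_real, Real.norm_of_nonneg (hw.pos 0).le] at this
    simpa [radial] using this
  · refine (mul_le_mul_of_nonneg_right (min_le_right _ _) hwz.le).trans ?_
    have hz0 : 0 < ‖z‖₊ := nnnorm_pos.2 hz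
    have hz0' : 0 < ‖z‖ := norm_pos_iff.2 hz
    have hzne : (‖z‖ : ℂ) ≠ 0 := by exact_mod_cast hz0'.ne'
    obtain ⟨j, hj, hjx⟩ := IsTropicalWith.exists_eq hE (Real.log ‖z‖)
    have hmono : ∀ t : ℝ≥0, 0 < t → Real.exp (b j) * (t : ℝ) ^ j ≤ v t := fun t ht => by
      have := IsTropicalWith.le hE hj (Real.log t)
      rw [← exp_logTransform hv ht]
      calc _ = Real.exp (b j + j * Real.log t) := by
            rw [Real.exp_add, Real.exp_nat_mul, Real.exp_log (NNReal.coe_pos.2 ht)]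
        _ ≤ _ := Real.exp_le_exp.2 this
    have hmono' : ∀ t : ℝ≥0, Real.exp (b j) * (t : ℝ) ^ j ≤ v t :=
      le_of_forall_pos_le (by fun_prop) hv.cont hmono
    have heq : Real.exp (b j) * ‖z‖ ^ j = v ‖z‖₊ := by
      rw [← exp_logTransform hv hz0, coe_nnnorm, ← hjx, Real.exp_add, Real.exp_nat_mul,
        Real.exp_log hz0']
    -- The extremal monomial at `z`, precomposed with the projection to the line of `z`.
    set f : Cd d → ℂ := fun ζ => ((Real.exp (b j) / C₂ : ℝ) : ℂ) * (inner ℂ z ζ / ‖z‖) ^ j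
    have hf : Differentiable ℂ f := by
      have : Differentiable ℂ fun ζ : Cd d => inner ℂ z ζ := (innerSL ℂ z).differentiable
      fun_prop
    have hfn : ∀ ζ, ‖f ζ‖ = Real.exp (b j) / C₂ * (‖inner ℂ z ζ‖ / ‖z‖) ^ j := fun ζ => by
      simp only [f]
      rw [norm_mul, norm_pow, norm_div, Complex.norm_real, Complex.norm_real, norm_norm,
        Real.norm_of_nonneg (by positivity)]
    refine le_trans ?_ (hge f hf (fun ζ => ?_) z)
    · rw [hfn, inner_self_eq_norm_sq_to_K]
      have : ‖((‖z‖ : ℂ)) ^ 2‖ / ‖z‖ = ‖z‖ := by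
        rw [norm_pow, Complex.norm_real, norm_norm]
        field_simp
      have h3 := (hwv ‖z‖₊).1
      erw [this]
      rw [div_mul_eq_mul_div, div_mul_eq_mul_div, heq]
      exact div_le_div_of_nonneg_right h3 h₂.le
    · rw [hfn]
      have h3 : ‖inner ℂ z ζ‖ / ‖z‖ ≤ ‖ζ‖ := by
        rw [div_le_iff₀ hz0', mul_comm]
        exact norm_inner_le_norm z ζ
      calc _ ≤ Real.exp (b j) / C₂ * ‖ζ‖ ^ j := by gcongr
        _ = Real.exp (b j) * ‖ζ‖ ^ j / C₂ := by ring
        _ ≤ v ‖ζ‖₊ / C₂ := div_le_div_of_nonneg_right (hmono' ‖ζ‖₊) h₂.le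
        _ ≤ _ := (div_le_iff₀ h₂).2 (by rw [mul_comm]; exact (hwv _).2)

/-- For positive coefficients the maximum modulus is the value on the positive half-line, so that
the sum of all series in `exists_dominated_splitting` can be used, as a function of `z 0`. -/
theorem isMaxApproximable_of_isTropicallyEquivalent {w : ℝ≥0 → ℝ} (h : IsTropicallyEquivalent w)
    {d : ℕ} (hd : 1 ≤ d) : IsMaxApproximable d w := by
  obtain ⟨v, hv, ⟨E, b, hE⟩, hwv⟩ := h
  obtain ⟨N, hN⟩ := exists_dominated_splitting one_pos
  obtain ⟨β, hβ, -, hmain⟩ := hN E b (logTransform v) hE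
  have hK := geomConst_pos
  set γ : ℕ → ℝ := fun j => ∑ c, β c j
  have hγ : ∀ j, 0 ≤ γ j := fun j => Finset.sum_nonneg fun c _ => hβ c j
  have hsγ : ∀ t : ℝ, 0 < t → Summable fun j => γ j * t ^ j := fun t ht => by
    simp only [γ, Finset.sum_mul]
    exact summable_sum fun c _ => (hmain t ht).1 c
  set i₀ : Fin d := ⟨0, hd⟩
  set f : Cd d → ℂ := fun z => ∑' j, (γ j : ℂ) * z i₀ ^ j
  have hle : ∀ j (z : Cd d), ‖(γ j : ℂ) * z i₀ ^ j‖ ≤ γ j * ‖z‖ ^ j := fun j z => by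
    rw [norm_mul, norm_pow, Complex.norm_real, Real.norm_of_nonneg (hγ j)]
    have := PiLp.norm_apply_le z i₀
    have := hγ j
    gcongr
  have hf : Differentiable ℂ f :=
    differentiable_tsum_of_norm_le hγ hsγ (fun j => by fun_prop) hle
  set p : ℝ≥0 → Cd d := fun t => ((t : ℝ) : ℂ) • EuclideanSpace.single i₀ 1
  have hfp : ∀ t, ‖f (p t)‖ = ∑' j, γ j * (t : ℝ) ^ j := fun t => by
    have : f (p t) = ((∑' j, γ j * (t : ℝ) ^ j : ℝ) : ℂ) := by
      simp only [f, p]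
      push_cast
      simp
    rw [this, Complex.norm_real, Real.norm_of_nonneg]
    exact tsum_nonneg fun j => mul_nonneg (hγ j) (by positivity)
  have hline : ∀ t, maxModulus f t = ‖f (p t)‖ := by
    intro t
    obtain ⟨z, hz, hfz⟩ := exists_norm_eq_maxModulus hd hf.continuous t
    refine le_antisymm ?_ ?_
    · rw [← hfz]
      rcases (zero_le (a := t)).eq_or_lt with rfl | ht
      · rw [nnnorm_eq_zero.1 hz]
        simp [p]
      · rw [hfp]
        refine tsum_of_norm_bounded (hsγ t (NNReal.coe_pos.2 ht)).hasSum fun j => ?_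
        rw [← hz]
        exact hle j z
    · have hpt : ‖p t‖₊ = t := by ext; simp [p, norm_smul]
      simpa [hpt] using norm_le_maxModulus hf.continuous (p t)
  have hgood : ∀ t : ℝ≥0, 0 < t → Real.exp (-1) * v t ≤ maxModulus f t ∧
      maxModulus f t ≤ N * geomConst * v t := by
    intro t ht
    obtain ⟨hs, hup, c, k, hk, -⟩ := hmain t (NNReal.coe_pos.2 ht)
    rw [exp_logTransform hv ht] at hk
    have hsum : ∑' j, γ j * (t : ℝ) ^ j = ∑ c, ∑' j, β c j * (t : ℝ) ^ j := by
      simp only [γ, Finset.sum_mul]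
      exact Summable.tsum_finsetSum fun c _ => hs c
    have hnn : ∀ c j, 0 ≤ β c j * (t : ℝ) ^ j := fun c j => mul_nonneg (hβ c j) (by positivity)
    rw [hline, hfp, hsum]
    constructor
    · refine hk.trans (((hs c).le_tsum k fun j _ => hnn c j).trans ?_)
      exact Finset.single_le_sum (f := fun c => ∑' j, β c j * (t : ℝ) ^ j)
        (fun c _ => tsum_nonneg (hnn c)) (Finset.mem_univ c)
    · refine (Finset.sum_le_sum fun c _ => hup c).trans_eq ?_
      rw [exp_logTransform hv ht]
      simp [mul_assoc]
  have hcont : Continuous (maxModulus f) := by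
    have hp : Continuous p := by fun_prop
    exact (hf.continuous.comp hp).norm.congr fun t => (hline t).symm
  have hN0 : 0 < N := (hmain 1 one_pos).2.2.choose.pos
  have hvc := hv.cont
  refine ⟨f, hf, (hwv.trans ⟨Real.exp (-1), N * geomConst, Real.exp_pos _, by positivity,
    fun t => ⟨?_, ?_⟩⟩).symm⟩
  · exact le_of_forall_pos_le (by fun_prop) hcont (fun s hs => (hgood s hs).1) t
  · exact le_of_forall_pos_le hcont (by fun_prop) (fun s hs => (hgood s hs).2) t

end RadialWeight

theorem theorem5p1 (w : ℝ≥0 → ℝ) (hw : RadialWeight.IsWeight w) :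
    List.TFAE [
      ∀ d : ℕ, 1 ≤ d → RadialWeight.IsApproximable d w,
      ∃ d : ℕ, 1 ≤ d ∧ RadialWeight.IsApproximable d w,
      ∀ d : ℕ, 1 ≤ d → RadialWeight.IsMaxApproximable d w,
      ∃ d : ℕ, 1 ≤ d ∧ RadialWeight.IsMaxApproximable d w,
      ∀ d : ℕ, 1 ≤ d → RadialWeight.IsEssential d w,
      ∃ d : ℕ, 1 ≤ d ∧ RadialWeight.IsEssential d w,
      RadialWeight.IsTropicallyEquivalent w] := by
  tfae_have 1 → 2 := fun h => ⟨1, le_rfl, h 1 le_rfl⟩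
  tfae_have 3 → 4 := fun h => ⟨1, le_rfl, h 1 le_rfl⟩
  tfae_have 5 → 6 := fun h => ⟨1, le_rfl, h 1 le_rfl⟩
  tfae_have 2 → 7 := fun ⟨_, hd, h⟩ => (h.isEssentialOnLine hd).isTropicallyEquivalent hw
  tfae_have 4 → 7 := fun ⟨_, hd, h⟩ => (h.isEssentialOnLine hd).isTropicallyEquivalent hw
  tfae_have 6 → 7 := fun ⟨_, hd, h⟩ => (h.isEssentialOnLine hd hw).isTropicallyEquivalent hw
  tfae_have 7 → 1 := fun h _ hd => RadialWeight.isApproximable_of_isTropicallyEquivalent h hd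
  tfae_have 7 → 3 := fun h _ hd => RadialWeight.isMaxApproximable_of_isTropicallyEquivalent h hd
  tfae_have 7 → 5 := fun h d _ => RadialWeight.isEssential_of_isTropicallyEquivalent hw h d
  tfae_finish
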